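/- For a group $G$ let $\mathcal Q(G)$ be the space of real-valued quasimorphisms on $G$ (functions $\alpha:G\to\mathbb R$ with $\sup_{g,h}|\alpha(gh)-\alpha(g)-\alpha(h)|<\infty$), and let $\mathcal H(G)\supseteq \mathrm{Hom}(G,\mathbb R)$ be the subspace of the homogeneous ones ($\alpha(g^n)=n\,\alpha(g)$ for all $g \in G$, $n\in\mathbb N$), with the topology of pointwise convergence. A map $f:G\to H$ between groups is called a quasimorphism if $\alpha\circ f\in\mathcal Q(G)$ for every $\alpha\in\mathcal Q(H)$; two quasimorphisms $f,f':G\to H$ are equivalent if $\alpha\circ f-\alpha\circ f'$ is bounded for every $\alpha\in\mathcal Q(H)$. Groups together with equivalence classes of quasimorphisms form a category, and $\mathrm{QOut}(G)$ denotes the automorphism group of $G$ in this category. It acts on $\mathcal H(G)$ (from the right): $[f]$ sends $\alpha$ to the homogenization of $\alpha\circ f$, i.e. to $g\mapsto\lim_{n\to\infty}\alpha(f(g^n))/n$. Let $\mathrm{QOut}_{(2)}(G)\le\mathrm{QOut}(G)$ be the subgroup generated by all elements of order at most $2$, and for a subgroup $\Gamma\le\mathrm{QOut}(G)$ let $\mathrm{span}(\Gamma.\mathrm{Hom}(G,\mathbb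 R))$ be the subspace of $\mathcal H(G)$ spanned by the images of homomorphisms under elements of $\Gamma$. Put \[d_0(G)=\dim\bigl(\mathcal H(G)/\mathrm{Hom}(G,\mathbb R)\bigr),\qquad d_{\mathrm{red}}(G)=\dim\Bigl(\mathcal H(G)/\overline{\mathrm{span}(\mathrm{QOut}(G).\mathrm{Hom}(G,\mathbb R))}\Bigr),\] both in $\mathbb N_0\cup\{\infty\}$, the closure being taken in the topology of pointwise convergence. Theorem. (1) For every $n\ge 1$, the free group $F_n$ of rank $n$ satisfies \[\mathcal H(F_n)=\overline{\mathrm{span}(\mathrm{QOut}_{(2)}(F_n).\mathrm{Hom}(F_n,\mathbb R))}.\] (2) If $F$ is a finitely generated non-abelian free group, then $d_0(F)=\infty$ and $d_{\mathrm{red}}(F)=0$. -/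

import Mathlib

universe u v w

noncomputable section

open Filter Topology CategoryTheory

/-! ### Real-valued quasimorphisms -/

/-- A real-valued function is bounded. -/
def IsBdd {X : Type u} (b : X → ℝ) : Prop := ∃ C : ℝ, ∀ x, |b x| ≤ C

theorem IsBdd.comp {X : Type u} {Y : Type v} {b : Y → ℝ} (hb : IsBdd b) (f : X → Y) :
    IsBdd (fun x => b (f x)) := by
  obtain ⟨C, hC⟩ := hb
  exact ⟨C, fun x => hC (f x)⟩

theorem IsBdd.add {X : Type u} {b c : X → ℝ} (hb : IsBdd b) (hc : IsBdd c) :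
    IsBdd (fun x => b x + c x) := by
  obtain ⟨C, hC⟩ := hb
  obtain ⟨D, hD⟩ := hc
  exact ⟨C + D, fun x => (abs_add_le _ _).trans (add_le_add (hC x) (hD x))⟩

/-- The space `𝒬(G)` of real-valued quasimorphisms on `G`: the functions `α : G → ℝ` for which
`|α (g * h) - α g - α h|` is bounded uniformly in `g` and `h`. -/
def RealQM (G : Type u) [Group G] : Submodule ℝ (G → ℝ) where
  carrier := {α | ∃ D : ℝ, ∀ g h : G, |α (g * h) - α g - α h| ≤ D}
  zero_mem' := ⟨0, fun g h => by simp⟩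
  add_mem' := by
    rintro α β ⟨D, hD⟩ ⟨E, hE⟩
    refine ⟨D + E, fun g h => ?_⟩
    have h1 := abs_le.1 (hD g h)
    have h2 := abs_le.1 (hE g h)
    simp only [Pi.add_apply]
    rw [abs_le]
    constructor <;> linarith [h1.1, h1.2, h2.1, h2.2]
  smul_mem' := by
    rintro c α ⟨D, hD⟩
    refine ⟨|c| * D, fun g h => ?_⟩
    simp only [Pi.smul_apply, smul_eq_mul]
    rw [← mul_sub, ← mul_sub, abs_mul]
    exact mul_le_mul_of_nonneg_left (hD g h) (abs_nonneg c)

/-- The space `ℋ(G)` of homogeneous real-valued quasimorphisms on `G`. As a subspace of `G → ℝ`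
it carries the topology of pointwise convergence. -/
def HomogQM (G : Type u) [Group G] : Submodule ℝ (G → ℝ) where
  carrier := {α | α ∈ RealQM G ∧ ∀ (g : G) (n : ℕ), α (g ^ n) = n * α g}
  zero_mem' := ⟨zero_mem _, fun g n => by simp⟩
  add_mem' := by
    rintro α β ⟨h1, h2⟩ ⟨h3, h4⟩
    refine ⟨add_mem h1 h3, fun g n => ?_⟩
    simp only [Pi.add_apply, h2, h4]
    ring
  smul_mem' := by
    rintro c α ⟨h1, h2⟩
    refine ⟨Submodule.smul_mem _ c h1, fun g n => ?_⟩
    simp only [Pi.smul_apply, smul_eq_mul, h2]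
    ring

/-- `Hom(G, ℝ)`, the space of homomorphisms from `G` to the additive group of the reals, as a
subspace of `ℋ(G)`. -/
def HomReal (G : Type u) [Group G] : Submodule ℝ (HomogQM G) where
  carrier := {α | ∀ g h : G, α.1 (g * h) = α.1 g + α.1 h}
  zero_mem' := fun g h => by simp
  add_mem' := by
    intro α β hα hβ g h
    simp only [Submodule.coe_add, Pi.add_apply, hα g h, hβ g h]
    ring
  smul_mem' := by
    intro c α hα g h
    simp only [Submodule.coe_smul, Pi.smul_apply, smul_eq_mul, hα g h]
    ring

/-- Every homomorphism to `ℝ` is a homogeneous quasimorphism, so `HomReal` misses none. -/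
theorem mem_HomogQM_of_hom {G : Type u} [Group G] (α : G →* Multiplicative ℝ) :
    (fun g => (α g).toAdd) ∈ HomogQM G :=
  ⟨⟨0, fun g h => by simp⟩, fun g n => by simp⟩

/-! ### Homogenization -/

/-- The homogenization `g ↦ lim α (g ^ n) / n` of `α`. -/
def homogenization {G : Type u} [Group G] (α : G → ℝ) (g : G) : ℝ :=
  limUnder atTop (fun n : ℕ => α (g ^ n) / n)

theorem abs_pow_sub_le {G : Type u} [Group G] {α : G → ℝ} {D : ℝ}
    (hD : ∀ g h : G, |α (g * h) - α g - α h| ≤ D) (g : G) (n : ℕ) :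
    |α (g ^ (n + 1)) - (n + 1) * α g| ≤ n * D := by
  induction n with
  | zero => simp
  | succ n ih =>
    have h1 := abs_le.1 (hD (g ^ (n + 1)) g)
    have h2 := abs_le.1 ih
    rw [pow_succ g (n + 1), abs_le]
    push_cast
    constructor <;> nlinarith [h1.1, h1.2, h2.1, h2.2]

/-- For a quasimorphism the limit that defines the homogenization exists. -/
theorem homogenization_tendsto {G : Type u} [Group G] {α : G → ℝ} (hα : α ∈ RealQM G) (g : G) :
    Tendsto (fun n : ℕ => α (g ^ n) / n) atTop (𝓝 (homogenization α g)) := by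
  obtain ⟨D, hD⟩ := hα
  have hD0 : 0 ≤ D := (abs_nonneg _).trans (hD 1 1)
  apply CauchySeq.tendsto_limUnder
  -- dividing the estimate for the powers of `g ^ m`
  have key : ∀ m k : ℕ, 0 < m → 0 < k →
      |α (g ^ (m * k)) / ((m * k : ℕ) : ℝ) - α (g ^ m) / m| ≤ D / m := by
    intro m k hm hk
    obtain ⟨j, rfl⟩ : ∃ j, k = j + 1 := ⟨k - 1, by omega⟩
    have h := abs_pow_sub_le hD (g ^ m) j
    rw [← pow_mul] at h
    have hm' : (0 : ℝ) < m := by exact_mod_cast hm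
    have hj' : (0 : ℝ) < (j : ℝ) + 1 := by positivity
    have e : α (g ^ (m * (j + 1))) / ((m * (j + 1) : ℕ) : ℝ) - α (g ^ m) / m
        = (α (g ^ (m * (j + 1))) - (j + 1) * α (g ^ m)) / (m * (j + 1)) := by
      push_cast
      field_simp
    rw [e, abs_div, abs_of_pos (mul_pos hm' hj'), div_le_div_iff₀ (mul_pos hm' hj') hm']
    calc _ ≤ (j * D) * m := mul_le_mul_of_nonneg_right h hm'.le
      _ ≤ D * (m * (j + 1)) := by nlinarith [mul_nonneg hD0 hm'.le]
  rw [Metric.cauchySeq_iff']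
  intro ε hε
  obtain ⟨N, hN⟩ := exists_nat_gt (2 * D / ε)
  refine ⟨N + 1, fun n hn => ?_⟩
  have hN1 : (0 : ℝ) < ((N + 1 : ℕ) : ℝ) := by positivity
  have hn1 : ((N + 1 : ℕ) : ℝ) ≤ n := by exact_mod_cast hn
  have hn0 : (0 : ℝ) < n := hN1.trans_le hn1
  have a := key n (N + 1) (by exact_mod_cast hn0) (by omega)
  have b := key (N + 1) n (by omega) (by exact_mod_cast hn0)
  rw [mul_comm (N + 1) n] at b
  have c : D / n ≤ D / ((N + 1 : ℕ) : ℝ) := div_le_div_of_nonneg_left hD0 hN1 hn1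
  have d : D / ((N + 1 : ℕ) : ℝ) < ε / 2 := by
    rw [div_lt_iff₀ hN1]
    rw [div_lt_iff₀ hε] at hN
    push_cast
    nlinarith
  rw [Real.dist_eq]
  have a' := abs_le.1 a
  have b' := abs_le.1 b
  rw [abs_lt]
  constructor <;> linarith [a'.1, a'.2, b'.1, b'.2]

/-- A quasimorphism is at bounded distance from its homogenization. -/
theorem isBdd_sub_homogenization {G : Type u} [Group G] {α : G → ℝ} (hα : α ∈ RealQM G) :
    IsBdd (fun g => α g - homogenization α g) := by
  have ht := homogenization_tendsto hα
  obtain ⟨D, hD⟩ := hα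
  have hD0 : 0 ≤ D := (abs_nonneg _).trans (hD 1 1)
  refine ⟨D, fun g => ?_⟩
  rw [abs_sub_comm]
  refine le_of_tendsto ((ht g).sub_const (α g)).abs ?_
  filter_upwards [eventually_gt_atTop 0] with n hn
  obtain ⟨j, rfl⟩ : ∃ j, n = j + 1 := ⟨n - 1, by omega⟩
  have h := abs_pow_sub_le hD g j
  have hj' : (0 : ℝ) < (j : ℝ) + 1 := by positivity
  have e : α (g ^ (j + 1)) / ((j + 1 : ℕ) : ℝ) - α g
      = (α (g ^ (j + 1)) - (j + 1) * α g) / (j + 1) := by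
    push_cast
    field_simp
  rw [e, abs_div, abs_of_pos hj', div_le_iff₀ hj']
  nlinarith

theorem mem_RealQM_of_isBdd {G : Type u} [Group G] {b : G → ℝ} (hb : IsBdd b) :
    b ∈ RealQM G := by
  obtain ⟨C, hC⟩ := hb
  refine ⟨3 * C, fun g h => ?_⟩
  have h1 := abs_le.1 (hC (g * h))
  have h2 := abs_le.1 (hC g)
  have h3 := abs_le.1 (hC h)
  rw [abs_le]
  constructor <;> linarith [h1.1, h1.2, h2.1, h2.2, h3.1, h3.2]

/-- The homogenization of a quasimorphism is a homogeneous quasimorphism. -/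
theorem homogenization_mem {G : Type u} [Group G] {α : G → ℝ} (hα : α ∈ RealQM G) :
    homogenization α ∈ HomogQM G := by
  refine ⟨?_, fun g n => ?_⟩
  · have h := sub_mem hα (mem_RealQM_of_isBdd (isBdd_sub_homogenization hα))
    have e : α - (fun g => α g - homogenization α g) = homogenization α := by
      funext g
      simp
    rwa [e] at h
  · rcases Nat.eq_zero_or_pos n with rfl | hn
    · have h1 := homogenization_tendsto hα (1 : G)
      simp only [one_pow] at h1
      have h2 : Tendsto (fun n : ℕ => α (1 : G) / n) atTop (𝓝 0) :=
        tendsto_const_div_atTop_nhds_zero_nat _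
      simpa using tendsto_nhds_unique h1 h2
    · have h1 := homogenization_tendsto hα (g ^ n)
      have h2 : Tendsto (fun k : ℕ => n * k) atTop atTop :=
        tendsto_id.const_mul_atTop' hn
      have h3 := ((homogenization_tendsto hα g).comp h2).const_mul (n : ℝ)
      refine tendsto_nhds_unique h1 (h3.congr fun k => ?_)
      have hn' : (n : ℝ) ≠ 0 := by exact_mod_cast hn.ne'
      simp only [Function.comp, pow_mul, Nat.cast_mul]
      rw [← mul_div_assoc, mul_div_mul_left _ _ hn']

/-- The homogenization is the only homogeneous function at bounded distance. -/
theorem homogenization_eq_of_isBdd {G : Type u} [Group G] {α β : G → ℝ} (hα : α ∈ RealQM G)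
    (hβ : ∀ (g : G) (n : ℕ), β (g ^ n) = n * β g) (hb : IsBdd (fun g => α g - β g)) :
    homogenization α = β := by
  funext g
  obtain ⟨C, hC⟩ := hb
  have h0 : Tendsto (fun n : ℕ => C / (n : ℝ)) atTop (𝓝 0) :=
    tendsto_const_div_atTop_nhds_zero_nat _
  have h1 : Tendsto (fun n : ℕ => α (g ^ n) / n - β g) atTop (𝓝 0) := by
    refine squeeze_zero_norm' ?_ h0
    filter_upwards [eventually_gt_atTop 0] with n hn
    have hn' : (0 : ℝ) < n := by exact_mod_cast hn
    have e : α (g ^ n) / n - β g = (α (g ^ n) - β (g ^ n)) / n := by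
      rw [hβ]
      field_simp
    rw [e, Real.norm_eq_abs, abs_div, abs_of_pos hn']
    exact div_le_div_of_nonneg_right (hC _) hn'.le
  have h2 := tendsto_nhds_unique h1 ((homogenization_tendsto hα g).sub_const (β g))
  linarith

/-! ### Quasimorphisms between groups and the category of homogeneous quasigroups -/

/-- A map between groups is a quasimorphism if it pulls back real-valued quasimorphisms to
real-valued quasimorphisms. -/
def IsQuasimorphism {G : Type u} {H : Type v} [Group G] [Group H] (f : G → H) : Prop :=
  ∀ α ∈ RealQM H, (fun g => α (f g)) ∈ RealQM G

/-- Quasimorphisms `f`, `f'` are equivalent if `α ∘ f - α ∘ f'` is bounded for every real-valued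
quasimorphism `α` on the target. -/
def quasimorphismSetoid (G : Type u) (H : Type v) [Group G] [Group H] :
    Setoid {f : G → H // IsQuasimorphism f} where
  r f f' := ∀ α ∈ RealQM H, IsBdd (fun g => α (f.1 g) - α (f'.1 g))
  iseqv :=
    { refl := fun f α _ => ⟨0, fun g => by simp⟩
      symm := fun {f f'} h α hα => by
        obtain ⟨C, hC⟩ := h α hα
        exact ⟨C, fun g => by rw [abs_sub_comm]; exact hC g⟩
      trans := fun {f f' f''} h h' α hα => by
        have h1 := (h α hα).add (h' α hα)
        simpa using h1 }

/-- Equivalence classes of quasimorphisms from `G` to `H`. -/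
def QQ (G : Type u) (H : Type v) [Group G] [Group H] : Type (max u v) :=
  Quotient (quasimorphismSetoid G H)

/-- The class `[f]` of a quasimorphism `f`. -/
def QQ.mk {G : Type u} {H : Type v} [Group G] [Group H] (f : G → H) (hf : IsQuasimorphism f) :
    QQ G H :=
  Quotient.mk (quasimorphismSetoid G H) ⟨f, hf⟩

/-- The class of the identity. -/
def QQ.id (G : Type u) [Group G] : QQ G G := QQ.mk (fun g => g) (fun _ hα => hα)

/-- Composition of classes, `[f]` followed by `[f']` being `[f' ∘ f]`. -/
def QQ.comp {G : Type u} {H : Type v} {K : Type w} [Group G] [Group H] [Group K]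
    (a : QQ G H) (b : QQ H K) : QQ G K :=
  Quotient.map₂ (sa := quasimorphismSetoid G H) (sb := quasimorphismSetoid H K)
    (sc := quasimorphismSetoid G K)
    (fun f f' => ⟨fun g => f'.1 (f.1 g), fun α hα => f.2 _ (f'.2 α hα)⟩)
    (by
      intro f₁ f₂ hf f'₁ f'₂ hf' α hα
      have h1 := hf _ (f'₁.2 α hα)
      have h2 := (hf' α hα).comp f₂.1
      simpa using h1.add h2) a b

/-- The category of homogeneous quasigroups: its objects are the groups. -/
structure HQGrp : Type (u + 1) where
  /-- the underlying type -/
  carrier : Type u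
  /-- the group structure -/
  [group : Group carrier]

attribute [instance] HQGrp.group

/-- The morphisms of homogeneous quasigroups are the equivalence classes of quasimorphisms. -/
instance : Category.{u} HQGrp.{u} where
  Hom G H := QQ G.carrier H.carrier
  id G := QQ.id G.carrier
  comp a b := QQ.comp a b
  id_comp a := by
    induction a using Quotient.inductionOn
    rfl
  comp_id a := by
    induction a using Quotient.inductionOn
    rfl
  assoc a b c := by
    induction a using Quotient.inductionOn
    induction b using Quotient.inductionOn
    induction c using Quotient.inductionOn
    rfl

/-- The quasioutomorphism group of `G`: its automorphism group in the category of homogeneous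
quasigroups. -/
abbrev QOut (G : Type u) [Group G] : Type u := Aut (HQGrp.mk G)

/-- The subgroup of `QOut G` generated by the elements of (finite) order at most `k`. -/
def QOutOrderLE (k : ℕ) (G : Type u) [Group G] : Subgroup (QOut G) :=
  Subgroup.closure {φ | IsOfFinOrder φ ∧ orderOf φ ≤ k}

/-! ### The action on homogeneous quasimorphisms -/

/-- For a quasimorphism `f : G → H`, the linear map from `ℋ(H)` to `ℋ(G)` that sends `α` to the
homogenization of `α ∘ f`. -/
def pullbackOfMap {G : Type u} {H : Type v} [Group G] [Group H] (f : G → H)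
    (hf : IsQuasimorphism f) : HomogQM H →ₗ[ℝ] HomogQM G where
  toFun α := ⟨homogenization (fun g => α.1 (f g)), homogenization_mem (hf α.1 α.2.1)⟩
  map_add' α β := by
    apply Subtype.ext
    funext g
    refine tendsto_nhds_unique (homogenization_tendsto (hf _ (α + β).2.1) g)
      (((homogenization_tendsto (hf α.1 α.2.1) g).add
        (homogenization_tendsto (hf β.1 β.2.1) g)).congr fun n => ?_)
    simp [add_div]
  map_smul' c α := by
    apply Subtype.ext
    funext g
    refine tendsto_nhds_unique (homogenization_tendsto (hf _ (c • α).2.1) g)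
      (((homogenization_tendsto (hf α.1 α.2.1) g).const_mul c).congr fun n => ?_)
    simp [mul_div_assoc]

/-- The pullback of homogeneous quasimorphisms along a class of quasimorphisms. -/
def QQ.pullback {G : Type u} {H : Type v} [Group G] [Group H] (a : QQ G H) :
    HomogQM H →ₗ[ℝ] HomogQM G :=
  Quotient.lift (s := quasimorphismSetoid G H) (fun f => pullbackOfMap f.1 f.2)
    (by
      intro f f' h
      refine LinearMap.ext fun α => Subtype.ext ?_
      have h' := homogenization_mem (f'.2 α.1 α.2.1)
      refine homogenization_eq_of_isBdd (f.2 α.1 α.2.1) h'.2 ?_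
      have h1 := (h α.1 α.2.1).add (isBdd_sub_homogenization (f'.2 α.1 α.2.1))
      simp only [sub_add_sub_cancel] at h1
      exact h1) a

/-- The (right) action of `QOut G` on `ℋ(G)`: the class `[f]` sends `α` to the homogenization of
`α ∘ f`. -/
def QOut.act {G : Type u} [Group G] (φ : QOut G) : HomogQM G →ₗ[ℝ] HomogQM G :=
  QQ.pullback φ.hom

/-- `span (Γ.Hom(G, ℝ))` for a subgroup `Γ` of `QOut G`: the subspace of `ℋ(G)` spanned by all the
translates of homomorphisms by elements of `Γ`. -/
def spanOrbitHom {G : Type u} [Group G] (Γ : Subgroup (QOut G)) : Submodule ℝ (HomogQM G) :=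
  Submodule.span ℝ {β | ∃ φ ∈ Γ, ∃ α ∈ HomReal G, β = QOut.act φ α}

/-- `d₀(G)`, the dimension of `ℋ(G) / Hom(G, ℝ)`. -/
def dZero (G : Type u) [Group G] : ℕ∞ :=
  Cardinal.toENat (Module.rank ℝ (HomogQM G ⧸ HomReal G))

/-- `d_red(G)`, the dimension of the quotient of `ℋ(G)` by the closure, in the topology of
pointwise convergence, of the span of `QOut(G).Hom(G, ℝ)`. -/
def dRed (G : Type u) [Group G] : ℕ∞ :=
  Cardinal.toENat
    (Module.rank ℝ (HomogQM G ⧸ (spanOrbitHom (⊤ : Subgroup (QOut G))).topologicalClosure))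

end

/-!
The density statement rests on a family of involutive quasimorphisms `f : F → F` that act on reduced
words by a local rule. Fix a two-letter word `x` and two words `m₀`, `m₁`, and let `f` exchange `m₀`
and `m₁` wherever they occur between two copies of `x`, and likewise for the inverse words. If the
patterns `x m₀ x`, `x m₁ x` and their inverses overlap each other in at most two letters and do not
contain each other (`FlankSwap.separated`), then exchanging creates no new pattern and destroys none, so `f` is an
involution on the nose (`FlankSwap.scan_scan`), commutes with inversion (`FlankSwap.scan_invRev`),
and is multiplicative up to a bounded factor on products without cancellation
(`FlankSwap.exists_scan_append`). Hence it is a quasimorphism of order at most two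
(`FlankSwap.isQuasimorphism_toFun`).

Let `u = p m q` be a cyclically reduced word without borders, i.e. no proper nonempty prefix of `u`
is a suffix. Exchanging `m` and `p ^ K q ^ K` between two copies of `q p`, for large `K`, is such a
rule. Let `χ` count the exponent of the letter `p`, and let `f^* χ` be the homogenization of
`χ ∘ f`. The difference `ψ = f^* χ - χ` does not vanish on `u`, since `f` turns powers of the rotation `q p m` into powers of `q p p ^ K q ^ K`. If `w` is
cyclically reduced and `|w| ≤ |u|`, then `ψ w = 0` unless `w` or its inverse is a rotation of `u`,
because no other periodic word with a period of that length contains one of the patterns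
(`exists_detecting`).

Now let `α` be a homogeneous quasimorphism that vanishes on all words of length less than `l`, but
not on some word of length `l`. That word is cyclically reduced up to conjugation, and its least
rotation `u` in a lexicographic order has no borders: a border would give `u = v s = s v` with
shorter words `v`, `s`, and `α` is additive on commuting elements
(`FreeGroup.exists_unbordered`). So `α` can be corrected on the words of length `l`, one conjugacy
class at a time, without a change on shorter words. By induction on `l`, every homogeneous
quasimorphism agrees on any finite set with a linear combination of translates of homomorphisms by
involutions (`FreeGroup.exists_eq_on_length_le`), which is density for pointwise convergence.

The functions `ψ` that belong to the unbordered words `a ^ (k + 1) b` form a triangular system that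
vanishes on the generators, so they are linearly independent modulo homomorphisms, and `d₀` is
infinite.
-/

noncomputable section

open Filter Topology CategoryTheory

/-! ### Local involutions on words -/

open FreeGroup in
/-- Data for a local involution on reduced words: a two-letter word `flank` and two words
`core false` and `core true`, to be exchanged wherever they occur between two copies of `flank`;
occurrences of the inverse words are treated in the mirrored way. -/
structure FlankSwap (ι : Type v) where ofData ::
  /-- the two-letter word that has to stand on both sides of a core -/
  flank : List (ι × Bool)
  /-- the two words that are exchanged -/
  core : Bool → List (ι × Bool)
  flank_length : flank.length = 2
  isReduced : ∀ k, IsReduced (flank ++ core k ++ flank)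
  /-- Patterns overlap in at most two letters and do not contain each other. The index `(k, e)`
  stands for the pattern with core `core k`, inverted if `e = true`. -/
  separated : ∀ (i j : Bool × Bool) (s : List (ι × Bool)),
    let pat : Bool × Bool → List (ι × Bool) := fun i =>
      bif i.2 then invRev (flank ++ core i.1 ++ flank) else flank ++ core i.1 ++ flank
    s <:+ pat i → 3 ≤ s.length → (s <+: pat j ∨ pat j <+: s) → s = pat i ∧ i = j

theorem FreeGroup.isReduced_invRev {ι : Type v} {L : List (ι × Bool)} (h : FreeGroup.IsReduced L) :
    FreeGroup.IsReduced (FreeGroup.invRev L) := by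
  classical
  rw [FreeGroup.isReduced_iff_reduce_eq] at h ⊢
  rw [FreeGroup.reduce_invRev, h]

namespace FlankSwap

open FreeGroup

variable {ι : Type v} (S : FlankSwap ι)

/-- The flank, inverted if `j.2` says so. -/
def mark (j : Bool × Bool) : List (ι × Bool) := bif j.2 then invRev S.flank else S.flank

/-- The core with index `j.1`, inverted if `j.2` says so. -/
def mid (j : Bool × Bool) : List (ι × Bool) :=
  bif j.2 then invRev (S.core j.1) else S.core j.1

/-- The pattern with index `j`: a core between two flanks. -/
def pat (j : Bool × Bool) : List (ι × Bool) := S.mark j ++ S.mid j ++ S.mark j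

/-- The index of the pattern that replaces the pattern with index `j`. -/
def other (j : Bool × Bool) : Bool × Bool := (!j.1, j.2)

/-- The index of the inverse of the pattern with index `j`. -/
def flip (j : Bool × Bool) : Bool × Bool := (j.1, !j.2)

@[simp] theorem other_other (j : Bool × Bool) : other (other j) = j := by simp [other]

@[simp] theorem mark_other (j : Bool × Bool) : S.mark (other j) = S.mark j := by
  simp [mark, other]

@[simp] theorem mark_flip (j : Bool × Bool) : S.mark (flip j) = invRev (S.mark j) := by
  obtain ⟨k, e⟩ := j
  cases e <;> simp [mark, flip]

@[simp] theorem mid_flip (j : Bool × Bool) : S.mid (flip j) = invRev (S.mid j) := by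
  obtain ⟨k, e⟩ := j
  cases e <;> simp [mid, flip]

theorem other_flip (j : Bool × Bool) : other (flip j) = flip (other j) := rfl

@[simp] theorem length_mark (j : Bool × Bool) : (S.mark j).length = 2 := by
  obtain ⟨k, e⟩ := j
  cases e <;> simp [mark, S.flank_length]

theorem pat_eq (j : Bool × Bool) :
    S.pat j = bif j.2 then invRev (S.flank ++ S.core j.1 ++ S.flank)
      else S.flank ++ S.core j.1 ++ S.flank := by
  obtain ⟨k, e⟩ := j
  cases e <;> simp [pat, mark, mid]

theorem pat_flip (j : Bool × Bool) : S.pat (flip j) = invRev (S.pat j) := by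
  simp [pat]

theorem length_pat (j : Bool × Bool) : (S.pat j).length = (S.mid j).length + 4 := by
  simp [pat]; omega

theorem isReduced_pat (j : Bool × Bool) : IsReduced (S.pat j) := by
  rw [pat_eq]
  cases j.2
  · exact S.isReduced _
  · exact isReduced_invRev (S.isReduced _)

theorem eq_of_overlap {i j : Bool × Bool} {s : List (ι × Bool)} (hs : s <:+ S.pat i)
    (h3 : 3 ≤ s.length) (h : s <+: S.pat j ∨ S.pat j <+: s) : s = S.pat i ∧ i = j := by
  have := S.separated i j s
  simp only [← pat_eq] at this
  exact this hs h3 h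

theorem pat_prefix_unique {i j : Bool × Bool} {W : List (ι × Bool)} (hi : S.pat i <+: W)
    (hj : S.pat j <+: W) : i = j :=
  (S.eq_of_overlap (List.suffix_refl _) (by rw [length_pat]; omega)
    (List.prefix_or_prefix_of_prefix hi hj)).2

open Classical in
/-- Reading a word from the left, exchange the cores in all patterns that occur in it. The right
flank of a pattern is read again, since it may be the left flank of the next one. -/
def scan (W : List (ι × Bool)) : List (ι × Bool) :=
  if h : ∃ j, S.pat j <+: W then
    S.mark h.choose ++ S.mid (other h.choose) ++
      scan (W.drop (S.mark h.choose ++ S.mid h.choose).length)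
  else
    match W with
    | [] => []
    | c :: R => c :: scan R
termination_by W.length
decreasing_by
  · have := h.choose_spec.length_le
    rw [length_pat] at this
    simp only [List.length_drop, List.length_append, length_mark]
    omega
  · simp

@[simp] theorem scan_nil : S.scan [] = [] := by
  rw [scan, dif_neg]
  rintro ⟨j, hj⟩
  have := hj.length_le
  rw [length_pat] at this
  simp at this

theorem scan_cons {c : ι × Bool} {R : List (ι × Bool)} (h : ∀ j, ¬ S.pat j <+: c :: R) :
    S.scan (c :: R) = c :: S.scan R := by
  rw [scan, dif_neg (by simpa using h)]

theorem scan_pat (j : Bool × Bool) (R : List (ι × Bool)) :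
    S.scan (S.mark j ++ S.mid j ++ (S.mark j ++ R)) =
      S.mark j ++ S.mid (other j) ++ S.scan (S.mark j ++ R) := by
  have hp : S.pat j <+: S.mark j ++ S.mid j ++ (S.mark j ++ R) := ⟨R, by simp [pat]⟩
  have h : ∃ j', S.pat j' <+: S.mark j ++ S.mid j ++ (S.mark j ++ R) := ⟨j, hp⟩
  have e : h.choose = j := S.pat_prefix_unique h.choose_spec hp
  rw [scan, dif_pos h, e, List.drop_left]

/-- Induction along the way in which `scan` reads a word. -/
theorem induction_scan {motive : List (ι × Bool) → Prop} (nil : motive [])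
    (hit : ∀ j R, motive (S.mark j ++ R) → motive (S.mark j ++ S.mid j ++ (S.mark j ++ R)))
    (miss : ∀ c R, (∀ j, ¬ S.pat j <+: c :: R) → motive R → motive (c :: R)) :
    ∀ W, motive W := by
  intro W
  induction hn : W.length using Nat.strong_induction_on generalizing W with
  | _ n ih =>
    by_cases h : ∃ j, S.pat j <+: W
    · obtain ⟨j, R, rfl⟩ := h
      have := hit j R (ih _ (by rw [← hn]; simp [pat]; omega) _ rfl)
      simpa [pat] using this
    · push Not at h
      match W, hn, h with
      | [], _, _ => exact nil
      | c :: R, hn, h => exact miss c R h (ih _ (by rw [← hn]; simp) _ rfl)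

/-- `scan` keeps the first two letters. -/
theorem take_two_scan (W : List (ι × Bool)) : (S.scan W).take 2 = W.take 2 := by
  induction W using S.induction_scan with
  | nil => simp
  | hit j R ih =>
    rw [scan_pat]
    simp only [List.append_assoc]
    rw [List.take_append_of_le_length (by simp), List.take_append_of_le_length (by simp)]
  | miss c R h ih =>
    rw [S.scan_cons h]
    have := congrArg (List.take 1) ih
    simpa [List.take_take] using this

theorem mark_prefix_scan (j : Bool × Bool) (R : List (ι × Bool)) :
    ∃ Z, S.scan (S.mark j ++ R) = S.mark j ++ Z := by
  have h := S.take_two_scan (S.mark j ++ R)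
  rw [List.take_left' (S.length_mark j)] at h
  exact ⟨(S.scan (S.mark j ++ R)).drop 2, by
    conv_lhs => rw [← List.take_append_drop 2 (S.scan (S.mark j ++ R)), h]⟩

/-- `scan` creates no new occurrences of proper suffixes of patterns: such an occurrence would
overlap a pattern in three letters. -/
theorem prefix_of_prefix_scan {i : Bool × Bool} {s R : List (ι × Bool)} (hs : s <:+ S.pat i)
    (hne : s ≠ S.pat i) (h : s <+: S.scan R) : s <+: R := by
  induction R using S.induction_scan generalizing s with
  | nil => simpa using h
  | hit j R ih =>
    by_cases h3 : 3 ≤ s.length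
    · exfalso
      rw [scan_pat] at h
      obtain ⟨Z, hZ⟩ := S.mark_prefix_scan j R
      refine hne (S.eq_of_overlap (j := other j) hs h3
        (List.prefix_or_prefix_of_prefix h ⟨Z, ?_⟩)).1
      rw [hZ]
      simp [pat]
    · have h2 := S.take_two_scan (S.mark j ++ S.mid j ++ (S.mark j ++ R))
      have h1 : s <+: (S.scan (S.mark j ++ S.mid j ++ (S.mark j ++ R))).take 2 :=
        List.prefix_take_iff.2 ⟨h, by omega⟩
      rw [h2] at h1
      exact h1.trans (List.take_prefix _ _)
  | miss c R hm ih =>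
    rw [S.scan_cons hm] at h
    match s, hs, hne, h with
    | [], _, _, _ => exact List.nil_prefix
    | d :: s, hs, hne, h =>
      rw [List.cons_prefix_cons] at h ⊢
      refine ⟨h.1, ih ((List.suffix_cons d s).trans hs) ?_ h.2⟩
      intro e
      have := hs.length_le
      rw [e] at this
      simp at this

theorem scan_scan (W : List (ι × Bool)) : S.scan (S.scan W) = W := by
  induction W using S.induction_scan with
  | nil => simp
  | hit j R ih =>
    obtain ⟨Z, hZ⟩ := S.mark_prefix_scan j R
    have := S.scan_pat (other j) Z
    rw [mark_other, other_other] at this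
    rw [scan_pat, hZ, this, ← hZ, ih]
  | miss c R h ih =>
    rw [S.scan_cons h, S.scan_cons, ih]
    rintro j hj
    refine h j ?_
    match hp : S.pat j with
    | [] => exact List.nil_prefix
    | d :: s =>
      rw [hp, List.cons_prefix_cons] at hj
      rw [List.cons_prefix_cons]
      refine ⟨hj.1, S.prefix_of_prefix_scan (i := j) ?_ ?_ hj.2⟩
      · rw [hp]; exact List.suffix_cons d s
      · rw [hp]; intro e
        simpa using congrArg List.length e

theorem scan_eq_self_of_length_le {W : List (ι × Bool)} (h : W.length ≤ 3) : S.scan W = W := by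
  induction W with
  | nil => simp
  | cons c R ih =>
    rw [S.scan_cons, ih (by simp at h; omega)]
    intro j hj
    have := hj.length_le
    rw [length_pat] at this
    omega

/-- A word in which no pattern occurs is left alone. -/
theorem scan_eq_self {W : List (ι × Bool)} (h : ∀ j, ¬ S.pat j <:+: W) : S.scan W = W := by
  induction W with
  | nil => simp
  | cons c R ih =>
    rw [S.scan_cons fun j hj => h j hj.isInfix,
      ih fun j hj => h j (hj.trans (List.suffix_cons c R).isInfix)]

/-! ### Compatibility of the local involution with inversion -/

/-- The mirror image of `scan_pat`. -/
theorem scan_append_pat (j : Bool × Bool) (A : List (ι × Bool)) :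
    S.scan (A ++ (S.mark j ++ S.mid j ++ S.mark j)) =
      S.scan (A ++ S.mark j) ++ (S.mid (other j) ++ S.mark j) := by
  induction hn : A.length using Nat.strong_induction_on generalizing A with
  | _ n ih =>
    match A, hn with
    | [], hn =>
      have := S.scan_pat j []
      simp only [List.append_nil] at this
      simp only [List.nil_append]
      rw [this, S.scan_eq_self_of_length_le (W := S.mark j) (by simp)]
      simp
    | a :: A, hn =>
      have hpre : a :: A ++ S.mark j <+: a :: A ++ (S.mark j ++ S.mid j ++ S.mark j) :=
        ⟨S.mid j ++ S.mark j, by simp⟩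
      by_cases h : ∃ k, S.pat k <+: a :: A ++ S.mark j
      · obtain ⟨k, R, hR⟩ := h
        have hl : (S.mark k ++ S.mid k).length ≤ (a :: A).length := by
          have := congrArg List.length hR
          simp only [List.length_append, length_pat, length_mark] at this ⊢
          omega
        have h1 : S.mark k ++ S.mid k ++ (S.mark k ++ R) = a :: A ++ S.mark j := by
          rw [← hR]; simp [pat]
        obtain ⟨A2, hA2⟩ : S.mark k ++ S.mid k <+: a :: A :=
          List.prefix_of_prefix_length_le ⟨_, h1⟩ (List.prefix_append _ _) hl
        rw [← hA2, List.append_assoc (S.mark k ++ S.mid k), List.append_cancel_left_eq] at h1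
        have hlen : A2.length < n := by
          rw [← hn, ← hA2]; simp; omega
        have key := ih _ hlen A2 rfl
        have e1 : A2 ++ (S.mark j ++ S.mid j ++ S.mark j) =
            S.mark k ++ (R ++ (S.mid j ++ S.mark j)) := by
          rw [← List.append_assoc (S.mark k), h1]; simp
        rw [← hA2, List.append_assoc _ A2, List.append_assoc _ A2, e1, scan_pat, ← e1, key,
          ← h1, scan_pat]
        simp
      · push Not at h
        have h' : ∀ k, ¬ S.pat k <+: a :: A ++ (S.mark j ++ S.mid j ++ S.mark j) := by
          intro k hk
          by_cases hl : (S.pat k).length ≤ (a :: A ++ S.mark j).length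
          · exact h k (List.prefix_of_prefix_length_le hk hpre hl)
          · obtain ⟨s, hs⟩ : a :: A <+: S.pat k :=
              List.prefix_of_prefix_length_le (List.prefix_append _ _) hk
                (by simp at hl ⊢; omega)
            -- a pattern that ends beyond the first flank overlaps pattern `j` in three letters
            rw [← hs, List.prefix_append_right_inj] at hk
            have := (S.eq_of_overlap (i := k) (j := j) (s := s) ⟨_, hs⟩ (by
              rw [← hs] at hl
              simp at hl; omega) (Or.inl hk)).1
            rw [← hs] at this
            have := congrArg List.length this
            simp at this
            omega
        rw [List.cons_append] at h h'
        rw [List.cons_append, List.cons_append, S.scan_cons h, S.scan_cons h',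
          ih A.length (by rw [← hn]; simp) A rfl]
        simp

/-- The mirror image of `scan_cons`. -/
theorem scan_concat {A : List (ι × Bool)} {c : ι × Bool} (h : ∀ j, ¬ S.pat j <:+ A ++ [c]) :
    S.scan (A ++ [c]) = S.scan A ++ [c] := by
  induction A using S.induction_scan with
  | nil => simp [S.scan_eq_self_of_length_le (W := [c])]
  | hit k R ih =>
    have := ih fun j hj => h j (hj.trans ⟨S.mark k ++ S.mid k, by simp⟩)
    rw [List.append_assoc _ (S.mark k ++ R), List.append_assoc (S.mark k) R, scan_pat,
      scan_pat, ← List.append_assoc (S.mark k) R, this]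
    simp
  | miss a R hm ih =>
    have hm' : ∀ j, ¬ S.pat j <+: a :: (R ++ [c]) := by
      intro j hj
      rw [← List.cons_append, List.prefix_concat_iff] at hj
      rcases hj with hj | hj
      · exact h j (by rw [hj])
      · exact hm j hj
    rw [List.cons_append, S.scan_cons hm, S.scan_cons hm',
      ih fun j hj => h j (hj.trans (List.suffix_cons _ _))]
    simp

theorem scan_invRev (W : List (ι × Bool)) : S.scan (invRev W) = invRev (S.scan W) := by
  induction W using S.induction_scan with
  | nil => simp
  | hit j R ih =>
    have h := S.scan_append_pat (flip j) (invRev R)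
    rw [other_flip, mark_flip, mid_flip, mid_flip] at h
    rw [scan_pat]
    simp only [invRev_append, List.append_assoc] at h ih ⊢
    rw [h, ih]
  | miss c R hm ih =>
    rw [S.scan_cons hm, invRev_cons, invRev_cons (L := S.scan R), ← ih]
    refine S.scan_concat fun j hj => hm (flip j) ?_
    obtain ⟨a, ha⟩ := hj
    refine ⟨invRev a, ?_⟩
    rw [pat_flip, ← invRev_append, ha]
    change invRev (invRev R ++ invRev [c]) = _
    rw [← invRev_cons, invRev_invRev]

/-! ### The local involution preserves reduced words -/

theorem isReduced_scan {W : List (ι × Bool)} (h : IsReduced W) : IsReduced (S.scan W) := by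
  induction W using S.induction_scan with
  | nil => simp
  | hit j R ih =>
    obtain ⟨Z, hZ⟩ := S.mark_prefix_scan j R
    have h1 := ih (h.infix (List.suffix_append _ _).isInfix)
    have h2 := S.isReduced_pat (other j)
    rw [scan_pat]
    rw [hZ] at h1 ⊢
    rw [pat, mark_other] at h2
    rw [← List.append_assoc]
    refine IsReduced.append_overlap h2 h1 ?_
    intro e
    simpa [e] using S.length_mark j
  | miss c R hm ih =>
    rw [S.scan_cons hm]
    have h1 := ih (h.infix (List.suffix_cons _ _).isInfix)
    have h2 := congrArg List.head? (S.take_two_scan R)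
    simp only [FreeGroup.IsReduced, List.isChain_cons, List.head?_take] at h h1 h2 ⊢
    simp only [OfNat.ofNat_ne_zero, if_false] at h2
    exact ⟨by rw [h2]; exact h.1, h1⟩

end FlankSwap

/-! ### The local involution as a quasimorphism -/

namespace FlankSwap

open FreeGroup

variable {ι : Type v} (S : FlankSwap ι)

/-- The group element by which the pattern with index `j` changes the value of `scan`. -/
def change (j : Bool × Bool) : FreeGroup ι :=
  mk (S.mark j ++ S.mid (other j)) * (mk (S.mark j ++ S.mid j))⁻¹

/-- Inside a pattern, after its first letter, `scan` changes nothing up to the right flank. -/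
theorem scan_append_of_suffix {j : Bool × Bool} {s R : List (ι × Bool)}
    (hs : s <:+ S.mark j ++ S.mid j) (hne : s ≠ S.mark j ++ S.mid j) :
    S.scan (s ++ (S.mark j ++ R)) = s ++ S.scan (S.mark j ++ R) := by
  induction s with
  | nil => simp
  | cons c s ih =>
    have hlen := hs.length_le
    rw [List.cons_append, S.scan_cons, ih ((List.suffix_cons c s).trans hs), List.cons_append]
    · rintro rfl
      simp at hlen
    · intro k hk
      rw [← List.cons_append, ← List.append_assoc] at hk
      refine hne ?_
      have := (S.eq_of_overlap (i := j) (j := k) (s := (c :: s) ++ S.mark j) ?_ (by simp)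
        (List.prefix_or_prefix_of_prefix (List.prefix_append _ R) hk)).1
      · rw [pat] at this
        exact List.append_cancel_right this
      · obtain ⟨a, ha⟩ := hs
        exact ⟨a, by rw [pat, ← ha]; simp⟩

/-- As a group element, `scan W` is a product of factors that depend only on the patterns at
the single positions of `W`. -/
theorem mk_scan_cons {j : Bool × Bool} {a : ι × Bool} {Y : List (ι × Bool)}
    (h : S.pat j <+: a :: Y) : mk (S.scan (a :: Y)) = S.change j * mk [a] * mk (S.scan Y) := by
  obtain ⟨R, hR⟩ := h
  obtain ⟨b, s, hs⟩ : ∃ b s, S.mark j ++ S.mid j = b :: s := by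
    refine List.exists_cons_of_ne_nil fun e => ?_
    have := congrArg List.length e
    simp at this
  have h1 : S.mark j ++ S.mid j ++ (S.mark j ++ R) = a :: Y := by
    rw [← hR]; simp [pat]
  have h2 := h1
  rw [hs, List.cons_append, List.cons.injEq] at h2
  have h3 := S.scan_append_of_suffix (j := j) (s := s) (R := R) (by
    rw [hs]; exact List.suffix_cons b s) (by
    rw [hs]; intro e
    have := congrArg List.length e
    simp at this)
  obtain ⟨rfl, rfl⟩ := h2
  rw [h3, ← h1, scan_pat, change, hs, ← mul_mk, ← mul_mk (L₁ := s), ← List.singleton_append (l := s),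
    ← mul_mk (L₁ := [b])]
  group

variable [DecidableEq ι]

/-- A prefix contributes to the value of `scan` a left factor of length linear in the prefix. -/
theorem exists_norm_le : ∃ C : ℕ, ∀ X Y : List (ι × Bool), ∃ c : FreeGroup ι,
    mk (S.scan (X ++ Y)) = c * mk (S.scan Y) ∧ norm c ≤ C * X.length := by
  refine ⟨∑ j, norm (S.change j) + 1, fun X Y => ?_⟩
  induction X with
  | nil => exact ⟨1, by simp⟩
  | cons a X ih =>
    obtain ⟨c, h1, h2⟩ := ih
    have ha : norm (mk [a]) ≤ 1 := norm_mk_le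
    by_cases h : ∃ j, S.pat j <+: a :: (X ++ Y)
    · obtain ⟨j, hj⟩ := h
      refine ⟨S.change j * mk [a] * c, by rw [List.cons_append, S.mk_scan_cons hj, h1]; group, ?_⟩
      have h3 := norm_mul_le (S.change j * mk [a]) c
      have h4 := norm_mul_le (S.change j) (mk [a])
      have h5 : norm (S.change j) ≤ ∑ j, norm (S.change j) :=
        Finset.single_le_sum (f := fun j => norm (S.change j)) (fun _ _ => Nat.zero_le _)
          (Finset.mem_univ j)
      rw [List.length_cons, Nat.mul_succ]
      omega
    · push Not at h
      refine ⟨mk [a] * c, ?_, ?_⟩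
      · rw [List.cons_append, S.scan_cons h, ← List.singleton_append, ← mul_mk, h1, mul_assoc]
      · have h3 := norm_mul_le (mk [a]) c
        rw [List.length_cons, Nat.mul_succ]
        omega

/-- `scan` respects concatenation up to a bounded group element in the middle, since only patterns
that run across the cut are treated differently. -/
theorem exists_scan_append : ∃ K : ℕ, ∀ X Y : List (ι × Bool), ∃ b : FreeGroup ι, norm b ≤ K ∧
    mk (S.scan (X ++ Y)) = mk (S.scan X) * b * mk (S.scan Y) := by
  obtain ⟨C, hC⟩ := S.exists_norm_le
  set M := ∑ j, (S.pat j).length with hM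
  have hMj : ∀ j, (S.pat j).length ≤ M := fun j =>
    Finset.single_le_sum (f := fun j => (S.pat j).length) (fun _ _ => Nat.zero_le _)
      (Finset.mem_univ j)
  refine ⟨C * M + C * M, fun X Y => ?_⟩
  induction X with
  | nil => exact ⟨1, by simp⟩
  | cons a X ih =>
    by_cases hl : M ≤ (a :: X).length
    · obtain ⟨b, hb, h⟩ := ih
      refine ⟨b, hb, ?_⟩
      have hiff : ∀ j, S.pat j <+: a :: (X ++ Y) ↔ S.pat j <+: a :: X := fun j =>
        ⟨fun hj => List.prefix_of_prefix_length_le hj (List.prefix_append (a :: X) Y)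
          ((hMj j).trans hl), fun hj => hj.trans (List.prefix_append (a :: X) Y)⟩
      by_cases hj : ∃ j, S.pat j <+: a :: X
      · obtain ⟨j, hj⟩ := hj
        rw [List.cons_append, S.mk_scan_cons ((hiff j).2 hj), S.mk_scan_cons hj, h]
        group
      · push Not at hj
        rw [List.cons_append, S.scan_cons hj, S.scan_cons fun j => (hiff j).not.2 (hj j),
          ← List.singleton_append, ← mul_mk, ← List.singleton_append (l := S.scan X), ← mul_mk, h]
        group
    · obtain ⟨c, hc, hc'⟩ := hC (a :: X) Y
      obtain ⟨d, hd, hd'⟩ := hC (a :: X) []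
      have hX : C * (a :: X).length ≤ C * M := Nat.mul_le_mul_left _ (by omega)
      simp only [List.append_nil, scan_nil, one_eq_mk.symm, mul_one] at hd
      refine ⟨d⁻¹ * c, ?_, ?_⟩
      · have := norm_mul_le d⁻¹ c
        rw [norm_inv_eq] at this
        omega
      · rw [hc, hd]
        group

/-- The map of the free group into itself that `scan` defines on reduced words. -/
def toFun (g : FreeGroup ι) : FreeGroup ι := mk (S.scan g.toWord)

theorem toFun_mk {L : List (ι × Bool)} (h : IsReduced L) : S.toFun (mk L) = mk (S.scan L) := by
  rw [toFun, toWord_mk, h.reduce_eq]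

theorem toFun_toFun (g : FreeGroup ι) : S.toFun (S.toFun g) = g := by
  rw [toFun.eq_def S g, S.toFun_mk (S.isReduced_scan isReduced_toWord), scan_scan, mk_toWord]

end FlankSwap

namespace FreeGroup

/-- In a product of reduced words, a common part `Y` cancels. -/
theorem exists_cancellation {ι : Type v} {L₁ L₂ : List (ι × Bool)} (h₁ : IsReduced L₁)
    (h₂ : IsReduced L₂) : ∃ X Y Z, L₁ = X ++ Y ∧ L₂ = invRev Y ++ Z ∧ IsReduced (X ++ Z) := by
  induction L₁ using List.reverseRecOn generalizing L₂ with
  | nil => exact ⟨[], [], L₂, by simpa using h₂⟩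
  | append_singleton L c ih =>
    by_cases h : ∃ L', L₂ = (c.1, !c.2) :: L'
    · obtain ⟨L', rfl⟩ := h
      obtain ⟨X, Y, Z, rfl, rfl, h⟩ := ih (h₁.infix (List.prefix_append _ _).isInfix)
        (h₂.infix (List.suffix_cons _ _).isInfix)
      exact ⟨X, Y ++ [c], Z, by simp, by simp [invRev], h⟩
    · refine ⟨L ++ [c], [], L₂, by simp, by simp, ?_⟩
      rw [IsReduced, List.isChain_append]
      refine ⟨h₁, h₂, fun a ha b hb e => ?_⟩
      simp only [List.getLast?_append, List.getLast?_singleton, Option.some_or,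
        Option.mem_def, Option.some.injEq] at ha
      subst ha
      by_contra hne
      obtain ⟨L', rfl⟩ : ∃ L', L₂ = b :: L' := by
        match L₂, hb with
        | d :: L', hb => exact ⟨L', by simpa using hb⟩
      refine h ⟨L', ?_⟩
      have : b = (c.1, !c.2) := by
        ext
        · exact e.symm
        · revert hne
          cases c.2 <;> cases b.2 <;> simp
      rw [this]

theorem finite_norm_le {ι : Type v} [DecidableEq ι] [Finite ι] (K : ℕ) :
    {g : FreeGroup ι | norm g ≤ K}.Finite :=
  (List.finite_length_le (ι × Bool) K).preimage toWord_injective.injOn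

end FreeGroup

/-- A real-valued quasimorphism is odd up to a bounded error. -/
theorem exists_abs_inv_add_le {G : Type u} [Group G] {α : G → ℝ} (hα : α ∈ RealQM G) :
    ∃ E : ℝ, ∀ g, |α g⁻¹ + α g| ≤ E := by
  obtain ⟨D, hD⟩ := hα
  refine ⟨D + |α 1|, fun g => ?_⟩
  have h := hD g⁻¹ g
  rw [inv_mul_cancel] at h
  have h1 := abs_le.1 h
  have h2 := neg_abs_le (α 1)
  have h3 := le_abs_self (α 1)
  rw [abs_le]
  constructor <;> linarith [h1.1, h1.2]

namespace FlankSwap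

open FreeGroup

variable {ι : Type v} [DecidableEq ι] [Finite ι] (S : FlankSwap ι)

theorem isQuasimorphism_toFun : IsQuasimorphism S.toFun := by
  intro α hα
  obtain ⟨E, hE⟩ := exists_abs_inv_add_le hα
  obtain ⟨D, hD⟩ := hα
  obtain ⟨K, hK⟩ := S.exists_scan_append
  obtain ⟨C, hC⟩ : ∃ C : ℝ, ∀ b : FreeGroup ι, norm b ≤ K → |α b| ≤ C := by
    obtain ⟨C, hC⟩ := ((finite_norm_le (ι := ι) K).image fun b => |α b|).bddAbove
    exact ⟨C, fun b hb => hC ⟨b, hb, rfl⟩⟩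
  -- additivity up to a bounded error in the case without cancellation
  have add : ∀ X Y : List (ι × Bool),
      |α (mk (S.scan (X ++ Y))) - α (mk (S.scan X)) - α (mk (S.scan Y))| ≤ 2 * D + C := by
    intro X Y
    obtain ⟨b, hb, h⟩ := hK X Y
    have h1 := abs_le.1 (hD (mk (S.scan X) * b) (mk (S.scan Y)))
    have h2 := abs_le.1 (hD (mk (S.scan X)) b)
    have h3 := abs_le.1 (hC b hb)
    rw [h, abs_le]
    constructor <;> linarith [h1.1, h1.2, h2.1, h2.2, h3.1, h3.2]
  refine ⟨3 * (2 * D + C) + E, fun g h => ?_⟩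
  obtain ⟨X, Y, Z, hX, hY, hr⟩ := exists_cancellation (isReduced_toWord (x := g))
    (isReduced_toWord (x := h))
  have e : g * h = mk (X ++ Z) := by
    rw [← mk_toWord (x := g), ← mk_toWord (x := h), hX, hY, ← mul_mk, ← mul_mk, ← inv_mk, ← mul_mk]
    group
  have h1 := abs_le.1 (add X Z)
  have h2 := abs_le.1 (add X Y)
  have h3 := abs_le.1 (add (invRev Y) Z)
  have h4 := abs_le.1 (hE (mk (S.scan Y)))
  rw [scan_invRev] at h3
  rw [inv_mk] at h4
  simp only [e, S.toFun_mk hr]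
  simp only [toFun, hX, hY]
  rw [abs_le]
  constructor <;> linarith [h1.1, h1.2, h2.1, h2.2, h3.1, h3.2, h4.1, h4.2]

end FlankSwap

/-! ### The exchange defined by an unbordered word -/

namespace FreeGroup

variable {ι : Type v}

theorem eq_nil_of_invRev_eq {L : List (ι × Bool)} (h : IsReduced L) (e : invRev L = L) :
    L = [] := by
  classical
  have h1 : mk L ^ 2 = 1 := by
    rw [pow_two]
    nth_rewrite 1 [← e]
    rw [← inv_mk, inv_mul_cancel]
  have h2 : mk L = 1 := (pow_eq_one_iff_left (by norm_num)).1 h1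
  have h3 := congrArg toWord h2
  rwa [toWord_mk, h.reduce_eq, toWord_one] at h3

theorem invRev_isPrefix {L L' : List (ι × Bool)} : invRev L <+: invRev L' ↔ L <:+ L' := by
  rw [invRev, invRev, List.reverse_prefix]
  constructor
  · rintro h
    have := h.map (fun x : ι × Bool => (x.1, !x.2))
    simpa [Function.comp_def] using this
  · exact fun h => h.map _

theorem invRev_isSuffix {L L' : List (ι × Bool)} : invRev L <:+ invRev L' ↔ L <+: L' := by
  rw [← invRev_isPrefix, invRev_invRev, invRev_invRev]

theorem mem_invRev {L : List (ι × Bool)} {c : ι × Bool} :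
    c ∈ invRev L ↔ (c.1, !c.2) ∈ L := by
  obtain ⟨i, b⟩ := c
  cases b <;> simp [invRev]

end FreeGroup

/-- A word is unbordered if none of its nonempty proper prefixes is also a suffix. -/
def List.Unbordered {A : Type v} (u : List A) : Prop :=
  ∀ v, v ≠ [] → v <+: u → v <:+ u → v = u

namespace FlankSwap

open FreeGroup

variable {ι : Type v}

section separation

variable {p q : ι × Bool} {m : List (ι × Bool)}

/-- The pattern around the core `p ^ K * q ^ K`. -/
theorem flank_replicate_eq (K : ℕ) :
    [q, p] ++ (List.replicate K p ++ List.replicate K q) ++ [q, p] =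
      [q] ++ (List.replicate (K + 1) p ++ (List.replicate (K + 1) q ++ [p])) := by
  rw [List.replicate_succ, List.replicate_succ']
  simp

theorem getElem?_long {K i : ℕ} :
    ([q, p] ++ (List.replicate K p ++ List.replicate K q) ++ [q, p])[i]? =
      if i = 0 then some q else if i ≤ K + 1 then some p else if i ≤ 2 * K + 2 then some q else
        if i = 2 * K + 3 then some p else none := by
  rw [flank_replicate_eq]
  simp only [List.getElem?_append, List.getElem?_replicate, List.length_replicate,
    List.length_singleton, List.getElem?_singleton]
  grind

theorem mem_long {K : ℕ} {c : ι × Bool}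
    (h : c ∈ [q, p] ++ (List.replicate K p ++ List.replicate K q) ++ [q, p]) : c = p ∨ c = q := by
  simp [List.mem_replicate] at h
  tauto

theorem isReduced_long (hpq : p.1 ≠ q.1) (K : ℕ) :
    IsReduced ([q, p] ++ (List.replicate K p ++ List.replicate K q) ++ [q, p]) := by
  rw [FreeGroup.IsReduced, List.isChain_iff_getElem]
  intro i hi
  have h1 := getElem?_long (p := p) (q := q) (K := K) (i := i)
  have h2 := getElem?_long (p := p) (q := q) (K := K) (i := i + 1)
  rw [List.getElem?_eq_getElem (by omega)] at h1 h2
  have := hpq.symm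
  grind

/-- The condition `FlankSwap.separated` for patterns that are not inverted. -/
theorem separated_positive (hub : (p :: (m ++ [q])).Unbordered) (hpq : p ≠ q) {K : ℕ}
    (hK : m.length + 2 ≤ K) (core : Bool → List (ι × Bool)) (h0 : core false = m)
    (h1 : core true = List.replicate K p ++ List.replicate K q) (k l : Bool) (s : List (ι × Bool))
    (hs : s <:+ [q, p] ++ core k ++ [q, p]) (h3 : 3 ≤ s.length)
    (h : s <+: [q, p] ++ core l ++ [q, p] ∨ [q, p] ++ core l ++ [q, p] <+: s) :
    s = [q, p] ++ core k ++ [q, p] ∧ k = l := by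
  have hlen0 : ([q, p] ++ core false ++ [q, p]).length = m.length + 4 := by simp [h0]
  have hlen1 : ([q, p] ++ core true ++ [q, p]).length = 2 * K + 4 := by simp [h1]; omega
  have hsl := hs.length_le
  -- the second letter from the end of the short pattern
  have hq : ([q, p] ++ core false ++ [q, p])[m.length + 2]? = some q := by
    rw [h0, List.getElem?_append_right (by simp)]
    simp
  cases k
  · cases l
    · refine ⟨?_, rfl⟩
      have hp : s <+: [q, p] ++ core false ++ [q, p] := by
        rcases h with h | h
        · exact h
        · rw [h.eq_of_length_le hsl]
      have e : [q, p] ++ core false ++ [q, p] = q :: ((p :: (m ++ [q])) ++ [p]) := by simp [h0]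
      rw [e] at hp hs ⊢
      match s, h3 with
      | c :: s', h3 =>
        rw [List.cons_prefix_cons, List.prefix_concat_iff] at hp
        obtain ⟨rfl, rfl | hp⟩ := hp
        · rfl
        · rw [← List.cons_append, List.suffix_concat_iff] at hs
          rcases hs with hs | ⟨t, ht, hs⟩
          · simp at hs
          · match t, ht with
            | [], ht =>
              have := congrArg List.length ht
              simp at this
              simp [this] at h3
            | d :: t, ht =>
              rw [List.cons_append, List.cons.injEq] at ht
              obtain ⟨rfl, rfl⟩ := ht
              have ht0 : t ≠ [] := by
                rintro rfl
                simp at h3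
              have hpt : t <+: p :: (m ++ [c]) := (List.prefix_append _ _).trans hp
              have hst : t <:+ p :: (m ++ [c]) := by
                rw [List.suffix_cons_iff] at hs
                rcases hs with hs | hs
                · rw [(List.cons.inj hs).2]
                · exact (List.suffix_cons _ _).trans hs
              have := hub t ht0 hpt hst
              have h5 := hp.length_le
              rw [this] at h5
              simp at h5
    · exfalso
      rcases h with h | h
      · -- the second letter of `s` from the end
        have a1 : s[s.length - 2]? = some q := by
          rw [List.suffix_iff_getElem?] at hs
          have := hs.2 (s.length - 2) (by omega)
          rw [← List.getElem?_eq_getElem (l := s)] at this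
          rw [← this, ← hq]
          congr 1
          omega
        rw [List.prefix_iff_getElem?] at h
        have a2 := h (s.length - 2) (by omega)
        rw [← List.getElem?_eq_getElem (l := s), a1, h1, getElem?_long, if_neg (by omega),
          if_pos (by omega)] at a2
        exact hpq (Option.some.inj a2)
      · have := h.length_le
        omega
  · have hs1 : s = [q, p] ++ core true ++ [q, p] := by
      have b : s[0]? = some q ∧ s[1]? = some p := by
        rcases h with h | h
        · rw [List.prefix_iff_getElem?] at h
          have a1 := h 0 (by omega)
          have a2 := h 1 (by omega)
          rw [← List.getElem?_eq_getElem (l := s)] at a1 a2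
          rw [← a1, ← a2]
          simp
        · obtain ⟨t, rfl⟩ := h
          simp
      have hs' := hs
      rw [List.suffix_iff_getElem?] at hs'
      have a1 := hs'.2 0 (by omega)
      have a2 := hs'.2 1 (by omega)
      rw [← List.getElem?_eq_getElem (l := s), b.1, hlen1, h1, getElem?_long] at a1
      rw [← List.getElem?_eq_getElem (l := s), b.2, hlen1, h1, getElem?_long] at a2
      refine hs.eq_of_length ?_
      rw [hlen1]
      have := hpq.symm
      grind
    refine ⟨hs1, ?_⟩
    cases l
    · exfalso
      have h' : [q, p] ++ core false ++ [q, p] <+: s := by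
        rcases h with h | h
        · have := h.length_le
          rw [hs1] at this
          omega
        · exact h
      rw [List.prefix_iff_getElem?] at h'
      have a := h' (m.length + 2) (by omega)
      rw [← List.getElem?_eq_getElem (l := [q, p] ++ core false ++ [q, p]), hq, hs1, h1,
        getElem?_long, if_neg (by omega), if_pos (by omega)] at a
      exact hpq (Option.some.inj a)
    · rfl

/-- The words `q p m` and `q p p ^ K q ^ K` are exchanged in front of `q p`, where `p m q` is an
unbordered word and `K` is large. -/
def ofUnbordered (p q : ι × Bool) (m : List (ι × Bool)) (hpq : p.1 ≠ q.1)
    (hred : IsReduced ([q, p] ++ m ++ [q, p])) (hub : (p :: (m ++ [q])).Unbordered) :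
    FlankSwap ι where
  flank := [q, p]
  core k := bif k then List.replicate (m.length + 2) p ++ List.replicate (m.length + 2) q else m
  flank_length := rfl
  isReduced k := by
    cases k
    · exact hred
    · exact isReduced_long hpq _
  separated := by
    have hpq' : p ≠ q := fun e => hpq (by rw [e])
    set K := m.length + 2 with hK
    set core : Bool → List (ι × Bool) := fun k =>
      bif k then List.replicate K p ++ List.replicate K q else m with hcore
    have pos := separated_positive hub hpq' hK.le core rfl rfl
    set P : Bool → List (ι × Bool) := fun k => [q, p] ++ core k ++ [q, p] with hP
    have hlen0 : (P false).length = m.length + 4 := by simp [hP, hcore]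
    have hlen1 : (P true).length = 2 * K + 4 := by simp [hP, hcore]; omega
    have hmem : ∀ c ∈ P true, c = p ∨ c = q := fun c hc => mem_long hc
    have hhead : ∀ k, (P k).head? = some q := fun k => by simp [hP]
    have hlast : ∀ k, (P k).getLast? = some p := fun k => by
      simp only [hP, List.getLast?_append]; simp
    have hhead' : ∀ k, (invRev (P k)).head? = some (p.1, !p.2) := fun k => by simp [hP, invRev]
    have hlast' : ∀ k, (invRev (P k)).getLast? = some (q.1, !q.2) := fun k => by
      simp only [hP, invRev_append, List.getLast?_append]; simp [invRev]
    -- comparable nonempty words start with the same letter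
    have hcomp : ∀ {s t : List (ι × Bool)}, s ≠ [] → t ≠ [] → (s <+: t ∨ t <+: s) →
        s.head? = t.head? := by
      rintro s t hs ht (⟨r, rfl⟩ | ⟨r, rfl⟩)
      · rw [List.head?_append_of_ne_nil _ hs]
      · rw [List.head?_append_of_ne_nil _ ht]
    have hself : ∀ {s : List (ι × Bool)}, s ≠ [] → s <+: P false → s = invRev s → False := by
      intro s hs hp e
      exact hs (eq_nil_of_invRev_eq (hred.infix hp.isInfix) e.symm)
    have hne : ∀ k, P k ≠ [] := fun k => by simp [hP]
    have hne' : ∀ k, invRev (P k) ≠ [] := fun k e => by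
      have := congrArg List.length e
      simp [hP] at this
    have hsuf : ∀ {s t : List (ι × Bool)}, s ≠ [] → s <:+ t → s.getLast? = t.getLast? := by
      rintro s t hs ⟨r, rfl⟩
      rw [List.getLast?_append_of_ne_nil _ hs]
    rintro ⟨k, e⟩ ⟨l, e'⟩ s pat hs h3 h
    have hs0 : s ≠ [] := by rintro rfl; simp at h3
    -- Pairs of equal sign reduce to `separated_positive`. For opposite signs, the first and last
    -- letters separate all pairs except the short pattern and its inverse, where the overlap would
    -- be a word equal to its own inverse.
    cases e <;> cases e'
    · have := pos k l s hs h3 h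
      exact ⟨this.1, by rw [this.2]⟩
    · exfalso
      change s <:+ P k at hs
      change s <+: invRev (P l) ∨ invRev (P l) <+: s at h
      have hlen := hs.length_le
      have a1 := hcomp hs0 (hne' l) h
      rw [hhead'] at a1
      have a2 := hsuf hs0 hs
      rw [hlast] at a2
      cases k
      · have h' : s <+: invRev (P l) := by
          rcases h with h | h
          · exact h
          · have := h.length_le
            cases l
            · rw [h.eq_of_length_le (by simpa using hlen)]
            · rw [invRev_length] at this
              omega
        cases l
        · rw [← invRev_invRev (L₁ := s), invRev_isPrefix] at h'
          have : s = invRev s := by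
            rcases List.suffix_or_suffix_of_suffix hs h' with g | g
            · exact g.eq_of_length (by simp)
            · exact (g.eq_of_length (by simp)).symm
          exact hs0 (eq_nil_of_invRev_eq (hred.infix hs.isInfix) this.symm)
        · have b := h'.subset (List.mem_of_getLast? a2)
          rw [mem_invRev] at b
          rcases hmem _ b with b | b
          · have := congrArg Prod.snd b
            simp at this
          · exact hpq (by simpa using congrArg Prod.fst b)
      · have b := hs.subset (List.mem_of_head? a1)
        rcases hmem _ b with b | b
        · have := congrArg Prod.snd b
          simp at this
        · exact hpq (by simpa using congrArg Prod.fst b)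
    · exfalso
      change s <:+ invRev (P k) at hs
      change s <+: P l ∨ P l <+: s at h
      have hlen := hs.length_le
      rw [invRev_length] at hlen
      have a1 := hcomp hs0 (hne l) h
      rw [hhead] at a1
      have a2 := hsuf hs0 hs
      rw [hlast'] at a2
      cases k
      · have h' : s <+: P l := by
          rcases h with h | h
          · exact h
          · have := h.length_le
            cases l
            · rw [h.eq_of_length_le hlen]
            · omega
        cases l
        · rw [← invRev_invRev (L₁ := s), invRev_isSuffix] at hs
          refine hself hs0 h' ?_
          rcases List.prefix_or_prefix_of_prefix h' hs with g | g
          · exact g.eq_of_length (by simp)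
          · exact (g.eq_of_length (by simp)).symm
        · rcases hmem _ (h'.subset (List.mem_of_getLast? a2)) with b | b
          · exact hpq (congrArg Prod.fst b).symm
          · have := congrArg Prod.snd b
            simp at this
      · have b := hs.subset (List.mem_of_head? a1)
        rw [mem_invRev] at b
        rcases hmem _ b with b | b
        · exact hpq (congrArg Prod.fst b).symm
        · have := congrArg Prod.snd b
          simp at this
    · change s <:+ invRev (P k) at hs
      change s <+: invRev (P l) ∨ invRev (P l) <+: s at h
      change s = invRev (P k) ∧ _
      rw [← invRev_invRev (L₁ := s), invRev_isSuffix] at hs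
      rcases h with h | h
      · rw [← invRev_invRev (L₁ := s), invRev_isPrefix] at h
        have := pos l k _ h (by simpa using h3) (Or.inl hs)
        refine ⟨?_, by rw [this.2]⟩
        rw [← this.2, ← invRev_invRev (L₁ := s), this.1]
      · rw [← invRev_invRev (L₁ := s), invRev_isPrefix] at h
        -- the pattern `P l` is contained in `P k`
        obtain ⟨b, hb⟩ := hs
        obtain ⟨a, ha⟩ := h
        have := pos k l (P l ++ b) ⟨a, by rw [← List.append_assoc, ha, hb]⟩
          (by rw [List.length_append]; cases l <;> omega) (Or.inr (List.prefix_append _ _))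
        have e1 : a ++ (P l ++ b) = P k := by rw [← List.append_assoc, ha, hb]
        have ea : a = [] := by
          have := congrArg List.length (e1.trans this.1.symm)
          simpa using this
        have eb : b = [] := by
          have h5 := congrArg List.length this.1
          rw [this.2] at h5
          change _ = (P l).length at h5
          simpa using h5
        subst ea eb
        refine ⟨?_, by rw [this.2]⟩
        rw [List.append_nil] at hb
        rw [← hb, invRev_invRev]

end separation

end FlankSwap

/-! ### Subwords of periodic words -/

/-- A subword of a power of `w` has period `|w|`. -/
theorem List.getElem?_add_period {A : Type v} {L w : List A} {n : ℕ}
    (h : L <:+: (List.replicate n w).flatten) {i : ℕ} (hi : i + w.length < L.length) :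
    L[i]? = L[i + w.length]? := by
  obtain ⟨a, b, hab⟩ := h
  match n, hab with
  | 0, hab =>
    have := congrArg List.length hab
    simp at this
    simp [this] at hi
  | n + 1, hab =>
    set W := (List.replicate (n + 1) w).flatten with hW
    have h1 : W = w ++ (List.replicate n w).flatten := by
      rw [hW, List.replicate_succ, List.flatten_cons]
    have h2 : W = (List.replicate n w).flatten ++ w := by
      rw [hW, List.replicate_succ', List.flatten_concat]
    have hlen := congrArg List.length hab
    have hlen2 := congrArg List.length h2
    simp only [List.length_append] at hlen hlen2
    have key : ∀ k, k < L.length → L[k]? = W[a.length + k]? := by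
      intro k hk
      rw [← hab, List.append_assoc, List.getElem?_append_right (by omega), Nat.add_sub_cancel_left,
        List.getElem?_append_left hk]
    rw [key _ (by omega), key _ hi]
    nth_rewrite 1 [h2]
    rw [h1, List.getElem?_append_left (by omega), List.getElem?_append_right (by omega)]
    congr 1
    omega

namespace FreeGroup

variable {ι : Type v}

/-- A subword of length `|w|` of a power of `w` is a rotation of `w`. -/
theorem isConj_of_isInfix {L w : List (ι × Bool)} {n : ℕ} (hl : L.length = w.length)
    (h : L <:+: (List.replicate n w).flatten) : IsConj (mk w) (mk L) := by
  obtain ⟨a, b, hab⟩ := h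
  rw [List.append_assoc] at hab
  induction a generalizing w b with
  | nil =>
    match n, hab with
    | 0, hab =>
      have := congrArg List.length hab
      simp at this
      have hw : w = [] := List.length_eq_zero_iff.1 (by rw [← hl, this.1]; rfl)
      rw [hw, this.1]
    | n + 1, hab =>
      rw [List.replicate_succ, List.flatten_cons, List.nil_append] at hab
      rw [(List.append_inj hab hl).1]
  | cons c a ih =>
    match n, w, hab, hl with
    | 0, w, hab, hl => simp at hab
    | n + 1, [], hab, hl => simp at hab
    | n + 1, d :: w, hab, hl =>
      -- rotate `w` by one letter
      have e : ∀ k, d :: (List.replicate k (w ++ [d])).flatten =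
          (List.replicate k (d :: w)).flatten ++ [d] := by
        intro k
        induction k with
        | zero => simp
        | succ k ih =>
          rw [List.replicate_succ, List.flatten_cons, List.replicate_succ, List.flatten_cons,
            List.append_assoc w, List.singleton_append, ih]
          simp
      have h1 := ih (w := w ++ [d]) (b := b ++ [d]) (by simpa using hl) (by
        have h2 := e (n + 1)
        rw [← hab, List.cons_append, List.cons_append] at h2
        rw [(List.cons.inj h2).2]
        simp)
      refine IsConj.trans ?_ h1
      rw [isConj_iff]
      refine ⟨(mk [d])⁻¹, ?_⟩
      rw [show d :: w = [d] ++ w from rfl, ← mul_mk, ← mul_mk]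
      group

theorem invRev_flatten_replicate (n : ℕ) (w : List (ι × Bool)) :
    invRev (List.replicate n w).flatten = (List.replicate n (invRev w)).flatten := by
  induction n with
  | zero => simp
  | succ n ih =>
    rw [List.replicate_succ', List.flatten_concat, invRev_append, ih, List.replicate_succ,
      List.flatten_cons]

theorem invRev_isInfix {L L' : List (ι × Bool)} (h : L <:+: L') : invRev L <:+: invRev L' := by
  obtain ⟨a, b, rfl⟩ := h
  exact ⟨invRev b, invRev a, by simp⟩

theorem mk_pow (w : List (ι × Bool)) (n : ℕ) : mk w ^ n = mk (List.replicate n w).flatten := by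
  induction n with
  | zero => simp [one_eq_mk]
  | succ n ih => rw [pow_succ, ih, mul_mk, List.replicate_succ', List.flatten_concat]

end FreeGroup

/-- An unbordered word does not occur in a periodic word with a shorter period. -/
theorem List.Unbordered.length_le {A : Type v} {u w : List A} (hu : u.Unbordered) (hu0 : u ≠ [])
    {n : ℕ} (h : u <:+: (List.replicate n w).flatten) : u.length ≤ w.length := by
  by_contra! hlt
  have e : u.drop w.length = u.take (u.length - w.length) := by
    apply List.ext_getElem?
    intro i
    rw [List.getElem?_drop, List.getElem?_take]
    split
    · rw [List.getElem?_add_period h (i := i) (by omega), add_comm]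
    · rw [List.getElem?_eq_none]
      omega
  have hw : w ≠ [] := by
    rintro rfl
    simp at h
    exact hu0 h
  have hw' := List.length_pos_of_ne_nil hw
  have := hu (u.drop w.length) (by simpa using hlt) (by rw [e]; exact List.take_prefix _ _)
    (List.drop_suffix _ _)
  have := congrArg List.length this
  rw [List.length_drop] at this
  omega

namespace FlankSwap

open FreeGroup

variable {ι : Type v} {p q : ι × Bool} {m : List (ι × Bool)} (hpq : p.1 ≠ q.1)
  (hred : IsReduced ([q, p] ++ m ++ [q, p])) (hub : (p :: (m ++ [q])).Unbordered)

/-- The patterns around an unbordered word `u` occur in a periodic word with a period of length at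
most `|u|` only if the period is a rotation of `u`. -/
theorem isConj_of_pat_isInfix {w : List (ι × Bool)} {n : ℕ} {j : Bool × Bool}
    (hw : w.length ≤ m.length + 2)
    (h : (ofUnbordered p q m hpq hred hub).pat j <:+: (List.replicate n w).flatten) :
    w.length = m.length + 2 ∧
      (IsConj (mk w) (mk (p :: (m ++ [q]))) ∨ IsConj (mk w)⁻¹ (mk (p :: (m ++ [q])))) := by
  have main : ∀ (w : List (ι × Bool)) (k : Bool), w.length ≤ m.length + 2 →
      (ofUnbordered p q m hpq hred hub).pat (k, false) <:+: (List.replicate n w).flatten →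
      w.length = m.length + 2 ∧ IsConj (mk w) (mk (p :: (m ++ [q]))) := by
    intro w k hw h
    cases k
    · have hu : p :: (m ++ [q]) <:+: (List.replicate n w).flatten := by
        refine List.IsInfix.trans ⟨[q], [p], ?_⟩ h
        simp [pat, mark, mid, ofUnbordered]
      have h1 := hub.length_le (by simp) hu
      simp only [List.length_cons, List.length_append, List.length_nil] at h1
      exact ⟨by omega, isConj_of_isInfix (by simp; omega) hu⟩
    · exfalso
      have hw0 : w ≠ [] := by
        rintro rfl
        have := h.length_le
        rw [length_pat] at this
        simp at this
      have hw1 := List.length_pos_of_ne_nil hw0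
      have e : (ofUnbordered p q m hpq hred hub).pat (true, false) =
          [q, p] ++ (List.replicate (m.length + 2) p ++ List.replicate (m.length + 2) q) ++
            [q, p] := rfl
      rw [e] at h
      -- the last `p` and the first `q` after it are a period apart from two letters `p`
      have h1 := List.getElem?_add_period h (i := m.length + 4 - w.length) (by simp; omega)
      rw [Nat.sub_add_cancel (by omega), getElem?_long, getElem?_long, if_neg (by omega),
        if_pos (by omega), if_neg (by omega), if_neg (by omega), if_pos (by omega)] at h1
      exact hpq (by rw [Option.some.inj h1])
  obtain ⟨k, e⟩ := j
  cases e
  · have := main w k hw h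
    exact ⟨this.1, Or.inl this.2⟩
  · have h1 := invRev_isInfix h
    rw [← pat_flip, invRev_flatten_replicate] at h1
    have := main (invRev w) k (by simpa using hw) h1
    rw [invRev_length, ← inv_mk] at this
    exact ⟨this.1, Or.inr this.2⟩

end FlankSwap

/-! ### Homogenization of pulled back homomorphisms -/

theorem homogenization_eq_of_abs_le {G : Type u} [Group G] {α : G → ℝ} {g : G} {c C : ℝ}
    (h : ∀ n : ℕ, |α (g ^ n) - n * c| ≤ C) : homogenization α g = c := by
  have h0 : Tendsto (fun n : ℕ => C / (n : ℝ)) atTop (𝓝 0) :=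
    tendsto_const_div_atTop_nhds_zero_nat _
  have h1 : Tendsto (fun n : ℕ => α (g ^ n) / n - c) atTop (𝓝 0) := by
    refine squeeze_zero_norm' ?_ h0
    filter_upwards [eventually_gt_atTop 0] with n hn
    have hn' : (0 : ℝ) < n := by exact_mod_cast hn
    have e : α (g ^ n) / n - c = (α (g ^ n) - n * c) / n := by field_simp
    rw [e, Real.norm_eq_abs, abs_div, abs_of_pos hn']
    exact div_le_div_of_nonneg_right (h n) hn'.le
  have h2 := h1.add_const c
  simp only [sub_add_cancel, zero_add] at h2
  exact h2.limUnder_eq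

/-- The value of a homogeneous quasimorphism at `g` is its growth rate along the powers of `g`. -/
theorem HomogQM.apply_eq_of_abs_le {G : Type u} [Group G] {α : G → ℝ} (hα : α ∈ HomogQM G)
    {g : G} {c C : ℝ} (h : ∀ n : ℕ, |α (g ^ n) - n * c| ≤ C) : α g = c := by
  have h1 : homogenization α g = α g := homogenization_eq_of_abs_le (C := 0) (by simp [hα.2])
  rw [← h1, homogenization_eq_of_abs_le h]

theorem HomogQM.apply_eq_of_isConj {G : Type u} [Group G] {α : G → ℝ} (hα : α ∈ HomogQM G)
    {g h : G} (hc : IsConj g h) : α h = α g := by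
  obtain ⟨c, rfl⟩ := isConj_iff.1 hc
  obtain ⟨D, hD⟩ := hα.1
  refine HomogQM.apply_eq_of_abs_le hα (C := 2 * D + |α c| + |α c⁻¹|) fun n => ?_
  rw [conj_pow, ← hα.2]
  have h1 := abs_le.1 (hD (c * g ^ n) c⁻¹)
  have h2 := abs_le.1 (hD c (g ^ n))
  have h3 := neg_abs_le (α c)
  have h4 := le_abs_self (α c)
  have h5 := neg_abs_le (α c⁻¹)
  have h6 := le_abs_self (α c⁻¹)
  rw [abs_le]
  constructor <;> linarith [h1.1, h1.2, h2.1, h2.2]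

theorem HomogQM.apply_mul_of_commute {G : Type u} [Group G] {α : G → ℝ} (hα : α ∈ HomogQM G)
    {g h : G} (hc : Commute g h) : α (g * h) = α g + α h := by
  obtain ⟨D, hD⟩ := hα.1
  refine HomogQM.apply_eq_of_abs_le hα (C := D) fun n => ?_
  have := hD (g ^ n) (h ^ n)
  rw [hα.2, hα.2] at this
  rw [hc.mul_pow]
  convert this using 2
  ring

theorem HomogQM.apply_inv {G : Type u} [Group G] {α : G → ℝ} (hα : α ∈ HomogQM G) (g : G) :
    α g⁻¹ = -α g := by
  have h := HomogQM.apply_mul_of_commute hα (Commute.refl g).inv_right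
  have h1 := hα.2 1 0
  rw [mul_inv_cancel] at h
  simp at h1
  linarith

/-- A homomorphism to `ℝ`, as a function. -/
def IsAdditive {G : Type u} [Group G] (χ : G → ℝ) : Prop := ∀ g h, χ (g * h) = χ g + χ h

theorem IsAdditive.mem_homogQM {G : Type u} [Group G] {χ : G → ℝ} (h : IsAdditive χ) :
    χ ∈ HomogQM G :=
  ⟨⟨0, fun g k => by simp [h g k]⟩, fun g n => by
    induction n with
    | zero => simpa using h 1 1
    | succ n ih =>
      rw [pow_succ, h, ih]
      push_cast
      ring⟩

/-- The homogeneous quasimorphisms obtained by letting involutive quasimorphisms `f : G → G`, with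
`f ∘ f = id` on the nose, act on the homomorphisms to `ℝ`. -/
def involutionTranslates (G : Type u) [Group G] : Set (G → ℝ) :=
  {β | ∃ f : G → G, IsQuasimorphism f ∧ (∀ g, f (f g) = g) ∧ ∃ χ : G → ℝ, IsAdditive χ ∧
    β = homogenization fun g => χ (f g)}

theorem involutionTranslates_subset {G : Type u} [Group G] :
    involutionTranslates G ⊆ HomogQM G := by
  rintro _ ⟨f, hf, -, χ, hχ, rfl⟩
  exact homogenization_mem (hf χ hχ.mem_homogQM.1)

theorem span_involutionTranslates_le {G : Type u} [Group G] :
    Submodule.span ℝ (involutionTranslates G) ≤ HomogQM G :=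
  Submodule.span_le.2 involutionTranslates_subset

theorem IsAdditive.mem_span {G : Type u} [Group G] {χ : G → ℝ} (h : IsAdditive χ) :
    χ ∈ Submodule.span ℝ (involutionTranslates G) := by
  refine Submodule.subset_span ⟨fun g => g, fun α hα => hα, fun _ => rfl, χ, h, ?_⟩
  funext g
  exact (homogenization_eq_of_abs_le (C := 0) (by simp [h.mem_homogQM.2])).symm

namespace FreeGroup

variable {ι : Type v}

/-- The homomorphism to `ℝ` with the given values on the generators. -/
def realHom (v : ι → ℝ) (g : FreeGroup ι) : ℝ :=
  (lift (fun i => Multiplicative.ofAdd (v i)) g).toAdd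

theorem isAdditive_realHom (v : ι → ℝ) : IsAdditive (realHom v) := fun g h => by simp [realHom]

theorem realHom_mk_cons (v : ι → ℝ) (c : ι × Bool) (L : List (ι × Bool)) :
    realHom v (mk (c :: L)) = (bif c.2 then v c.1 else -v c.1) + realHom v (mk L) := by
  obtain ⟨i, b⟩ := c
  cases b <;> simp [realHom]

theorem realHom_mk_append (v : ι → ℝ) (L L' : List (ι × Bool)) :
    realHom v (mk (L ++ L')) = realHom v (mk L) + realHom v (mk L') := by
  rw [← mul_mk, isAdditive_realHom]

theorem realHom_mk_nil (v : ι → ℝ) : realHom v (mk []) = 0 := by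
  simp [realHom]

theorem abs_realHom_mk_le {v : ι → ℝ} (hv : ∀ i, |v i| ≤ 1) (L : List (ι × Bool)) :
    |realHom v (mk L)| ≤ L.length := by
  induction L with
  | nil => simp [realHom_mk_nil]
  | cons c L ih =>
    rw [realHom_mk_cons]
    refine (abs_add_le _ _).trans ?_
    have : |(bif c.2 then v c.1 else -v c.1)| ≤ 1 := by
      cases c.2 <;> simp [hv]
    push_cast [List.length_cons]
    linarith

theorem realHom_mk_replicate (v : ι → ℝ) (c : ι × Bool) (n : ℕ) :
    realHom v (mk (List.replicate n c)) = n * (bif c.2 then v c.1 else -v c.1) := by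
  induction n with
  | zero => simp [realHom_mk_nil]
  | succ n ih =>
    rw [List.replicate_succ, realHom_mk_cons, ih]
    push_cast
    ring

end FreeGroup

namespace FlankSwap

open FreeGroup

variable {ι : Type v} [DecidableEq ι]

/-- Elements whose powers contain no pattern are not affected by the involution. -/
theorem homogenization_eq_self (S : FlankSwap ι) {χ : FreeGroup ι → ℝ} (hχ : IsAdditive χ)
    {w : List (ι × Bool)} (hw : IsCyclicallyReduced w)
    (h : ∀ n j, ¬ S.pat j <:+: (List.replicate n w).flatten) :
    homogenization (fun g => χ (S.toFun g)) (mk w) = χ (mk w) := by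
  refine homogenization_eq_of_abs_le (C := 0) fun n => ?_
  have e : S.toFun (mk w ^ n) = mk w ^ n := by
    rw [mk_pow, S.toFun_mk (hw.flatten_replicate n).isReduced, S.scan_eq_self (h n)]
  rw [e, hχ.mem_homogQM.2]
  simp

/-- On a periodic sequence of patterns every core is exchanged. -/
theorem homogenization_mark_mid (S : FlankSwap ι) {χ : FreeGroup ι → ℝ} (hχ : IsAdditive χ)
    (j : Bool × Bool) (hw : IsCyclicallyReduced (S.mark j ++ S.mid j)) :
    homogenization (fun g => χ (S.toFun g)) (mk (S.mark j ++ S.mid j)) =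
      χ (mk (S.mark j ++ S.mid (other j))) := by
  set c := χ (mk (S.mark j ++ S.mid (other j))) with hc
  set C := |χ (mk (S.scan (S.mark j ++ S.mid j)))| + |c| with hC
  refine homogenization_eq_of_abs_le (C := C) fun n => ?_
  have key : ∀ n : ℕ, χ (mk (S.scan (List.replicate (n + 1) (S.mark j ++ S.mid j)).flatten)) =
      n * c + χ (mk (S.scan (S.mark j ++ S.mid j))) := by
    intro n
    induction n with
    | zero => simp
    | succ n ih =>
      obtain ⟨R, hR⟩ : ∃ R, (List.replicate (n + 1) (S.mark j ++ S.mid j)).flatten =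
          S.mark j ++ R :=
        ⟨S.mid j ++ (List.replicate n (S.mark j ++ S.mid j)).flatten, by
          rw [List.replicate_succ, List.flatten_cons, List.append_assoc]⟩
      rw [List.replicate_succ, List.flatten_cons, hR, scan_pat, ← hR, ← mul_mk, hχ, ih]
      push_cast
      ring
  match n with
  | 0 =>
    have : χ (S.toFun (mk (S.mark j ++ S.mid j) ^ 0)) = 0 := by
      have h1 : S.toFun 1 = 1 := by simp [toFun, one_eq_mk]
      have h2 := hχ 1 1
      rw [pow_zero, h1]
      simp at h2
      exact h2
    rw [this]
    simp [hC]
    positivity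
  | n + 1 =>
    rw [mk_pow, S.toFun_mk (hw.flatten_replicate _).isReduced, key]
    push_cast
    have h1 : (n : ℝ) * c + χ (mk (S.scan (S.mark j ++ S.mid j))) - (n + 1) * c =
      χ (mk (S.scan (S.mark j ++ S.mid j))) - c := by ring
    rw [h1]
    exact abs_sub _ _

end FlankSwap

open FreeGroup in
/-- Every cyclically reduced unbordered word `u` of length at least two is detected by a member of
the span that vanishes on all other conjugacy classes of words of length at most `|u|`, up to
inversion. -/
theorem exists_detecting {ι : Type v} [DecidableEq ι] [Finite ι] {u : List (ι × Bool)}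
    (hu : IsCyclicallyReduced u) (hub : u.Unbordered) (h2 : 2 ≤ u.length) :
    ∃ ψ ∈ Submodule.span ℝ (involutionTranslates (FreeGroup ι)), ψ (mk u) ≠ 0 ∧
      ∀ w, IsCyclicallyReduced w → w.length ≤ u.length → ψ (mk w) ≠ 0 →
        w.length = u.length ∧ (IsConj (mk w) (mk u) ∨ IsConj (mk w)⁻¹ (mk u)) := by
  obtain ⟨p, m, q, rfl⟩ : ∃ p m q, u = p :: (m ++ [q]) := by
    match u, h2 with
    | p :: v, h2 =>
      rcases List.eq_nil_or_concat v with rfl | ⟨m, q, rfl⟩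
      · simp at h2
      · exact ⟨p, m, q, by simp⟩
  have hpq' : p ≠ q := by
    rintro rfl
    have := hub [p] (by simp) ⟨m ++ [p], by simp⟩ ⟨p :: m, by simp⟩
    simp at this
  have hcyc := isCyclicallyReduced_cons_append_iff.1 hu
  have hpq : p.1 ≠ q.1 := fun e => hpq' (Prod.ext e (hcyc.2 e.symm).symm)
  have hred : IsReduced ([q, p] ++ m ++ [q, p]) := by
    have h3 := (hu.flatten_replicate 3).isReduced
    refine h3.infix ⟨p :: m, m ++ [q], by simp [List.replicate]⟩
  set S := FlankSwap.ofUnbordered p q m hpq hred hub with hS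
  set v : ι → ℝ := fun i => if i = p.1 then 1 else 0 with hv
  have hχ := isAdditive_realHom v
  refine ⟨(homogenization fun g => realHom v (S.toFun g)) - realHom v, Submodule.sub_mem _
    (Submodule.subset_span ⟨S.toFun, S.isQuasimorphism_toFun, S.toFun_toFun, _, hχ, rfl⟩)
    hχ.mem_span, ?_, ?_⟩
  · -- `q p m` is the rotation of `u` at which the cores are exchanged
    have hrot : IsConj (mk (p :: (m ++ [q]))) (mk ([q, p] ++ m)) := by
      rw [isConj_iff]
      refine ⟨mk [q], ?_⟩
      have e1 : p :: (m ++ [q]) = [p] ++ m ++ [q] := by simp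
      have e2 : [q, p] ++ m = [q] ++ ([p] ++ m) := by simp
      rw [e1, e2, ← mul_mk, ← mul_mk (L₁ := [q])]
      group
    have hmem : ((homogenization fun g => realHom v (S.toFun g)) - realHom v) ∈
        HomogQM (FreeGroup ι) :=
      Submodule.sub_mem _ (homogenization_mem (S.isQuasimorphism_toFun _ hχ.mem_homogQM.1))
        hχ.mem_homogQM
    rw [← HomogQM.apply_eq_of_isConj hmem hrot]
    have h4 := S.homogenization_mark_mid hχ (false, false) (by
      change IsCyclicallyReduced ([q, p] ++ m)
      refine ⟨hred.infix (List.prefix_append _ _).isInfix, fun a ha b hb e => ?_⟩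
      have hb' : q = b := by simpa using hb
      subst hb'
      rcases List.eq_nil_or_concat m with rfl | ⟨m', c, rfl⟩
      · have : p = a := by simpa using ha
        exact absurd (this ▸ e) hpq
      · have hc : c = a := by
          rw [List.concat_eq_append, ← List.append_assoc, List.getLast?_concat] at ha
          simpa using ha
        subst hc
        have h5 : IsReduced [c, q] := hred.infix ⟨[q, p] ++ m', [p], by simp⟩
        simp only [FreeGroup.IsReduced, List.isChain_pair] at h5
        exact h5 e)
    change homogenization (fun g => realHom v (S.toFun g)) (mk ([q, p] ++ m)) = realHom v
      (mk ([q, p] ++ (List.replicate (m.length + 2) p ++ List.replicate (m.length + 2) q))) at h4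
    rw [Pi.sub_apply, h4, realHom_mk_append, realHom_mk_append, realHom_mk_append,
      realHom_mk_replicate, realHom_mk_replicate]
    have hvq : v q.1 = 0 := by simp [hv, hpq.symm]
    have hvp : v p.1 = 1 := by simp [hv]
    have hm := abs_le.1 (abs_realHom_mk_le (v := v) (fun i => by
      simp only [hv]; split <;> simp) m)
    rw [hvq, hvp]
    push_cast
    intro e0
    rcases hb : p.2 <;> simp only [hb, cond_true, cond_false, neg_zero, Bool.cond_self] at e0 <;>
      linarith [hm.1, hm.2]
  · intro w hw hlen hne
    have hlen' : w.length ≤ m.length + 2 := by simpa using hlen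
    by_cases h : ∃ n j, S.pat j <:+: (List.replicate n w).flatten
    · obtain ⟨n, j, h⟩ := h
      have := FlankSwap.isConj_of_pat_isInfix hpq hred hub hlen' h
      exact ⟨by simpa using this.1, this.2⟩
    · push Not at h
      refine absurd ?_ hne
      rw [Pi.sub_apply, S.homogenization_eq_self hχ hw h, sub_self]

/-! ### Unbordered representatives -/

namespace FreeGroup

variable {ι : Type v}

theorem isCyclicallyReduced_iff_isReduced_append {L : List (ι × Bool)} :
    IsCyclicallyReduced L ↔ IsReduced (L ++ L) := by
  rw [IsCyclicallyReduced, IsReduced, IsReduced, List.isChain_append]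
  tauto

theorem IsCyclicallyReduced.append_comm {x y : List (ι × Bool)}
    (h : IsCyclicallyReduced (x ++ y)) : IsCyclicallyReduced (y ++ x) := by
  rw [isCyclicallyReduced_iff_isReduced_append]
  refine (h.flatten_replicate 3).isReduced.infix ⟨x, y, ?_⟩
  simp [List.replicate]

theorem isConj_mk_append_comm (x y : List (ι × Bool)) : IsConj (mk (x ++ y)) (mk (y ++ x)) := by
  rw [isConj_iff]
  refine ⟨(mk x)⁻¹, ?_⟩
  rw [← mul_mk, ← mul_mk]
  group

theorem exists_isConj_isCyclicallyReduced (L : List (ι × Bool)) :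
    ∃ w, IsCyclicallyReduced w ∧ w.length ≤ L.length ∧ IsConj (mk L) (mk w) := by
  classical
  have hr : IsReduced (reduce L) := IsReduced.of_reduce_eq reduce.idem
  have e := reduceCyclically.conj_conjugator_reduceCyclically (reduce L)
  refine ⟨_, reduceCyclically.isCyclicallyReduced hr, ?_, ?_⟩
  · have h1 := congrArg List.length e
    have h2 : (reduce L).length ≤ L.length := by
      rw [← toWord_mk]
      exact norm_mk_le
    simp only [List.length_append] at h1
    omega
  · refine IsConj.symm (isConj_iff.2 ⟨mk (reduceCyclically.conjugator (reduce L)), ?_⟩)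
    rw [inv_mk, mul_mk, mul_mk, e, reduce.self]

/-- A shortest conjugacy class on which a homogeneous quasimorphism does not vanish contains an
unbordered word: the rotation that is minimal in the lexicographic order has this property unless it
is a product of two shorter commuting words. -/
theorem exists_unbordered [Finite ι] {α : FreeGroup ι → ℝ} (hα : α ∈ HomogQM (FreeGroup ι))
    {w : List (ι × Bool)} (hw : IsCyclicallyReduced w)
    (h0 : ∀ L : List (ι × Bool), L.length < w.length → α (mk L) = 0) (hne : α (mk w) ≠ 0) :
    ∃ u : List (ι × Bool), IsCyclicallyReduced u ∧ u.Unbordered ∧ u.length = w.length ∧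
      IsConj (mk w) (mk u) := by
  obtain ⟨B, ⟨e⟩⟩ := Finite.exists_equiv_fin (ι × Bool)
  -- the word read as a number in base `B + 2`
  set val : List (ι × Bool) → ℕ := fun L => Nat.ofDigits (B + 2) (L.map fun c => (e c : ℕ))
    with hval
  have hB : ∀ L : List (ι × Bool), ∀ d ∈ L.map fun c => (e c : ℕ), d < B + 2 := by
    intro L d hd
    obtain ⟨c, -, rfl⟩ := List.mem_map.1 hd
    have := (e c).2
    omega
  have happ : ∀ x y, val (x ++ y) = val x + (B + 2) ^ x.length * val y := fun x y => by
    simp only [hval, List.map_append, Nat.ofDigits_append, List.length_map]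
  -- a conjugate of least value; it is at most each of its own rotations
  obtain ⟨u, ⟨hu1, hu2, hu3⟩, hmin⟩ := (measure val).wf.has_min
    {u | IsCyclicallyReduced u ∧ u.length = w.length ∧ IsConj (mk w) (mk u)}
    ⟨w, hw, rfl, IsConj.refl _⟩
  refine ⟨u, hu1, ?_, hu2, hu3⟩
  rintro v hv ⟨s, hs⟩ ⟨t, ht⟩
  by_contra hvu
  have hs0 : s ≠ [] := by
    rintro rfl
    exact hvu (by simpa using hs)
  have hlen : s.length = t.length := by
    have h1 := congrArg List.length hs
    have h2 := congrArg List.length ht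
    simp only [List.length_append] at h1 h2
    omega
  have m1 : val (v ++ s) ≤ val (v ++ t) := by
    have := hmin (v ++ t) ⟨(ht ▸ hu1).append_comm, by rw [← hu2, ← ht]; simp [add_comm], by
      refine hu3.trans ?_
      rw [← ht]
      exact isConj_mk_append_comm t v⟩
    rw [hs]
    exact not_lt.1 this
  have m2 : val (t ++ v) ≤ val (s ++ v) := by
    have := hmin (s ++ v) ⟨(hs ▸ hu1).append_comm, by rw [← hu2, ← hs]; simp [add_comm], by
      refine hu3.trans ?_
      rw [← hs]
      exact isConj_mk_append_comm v s⟩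
    rw [ht]
    exact not_lt.1 this
  rw [happ, happ] at m1 m2
  rw [hlen] at m2
  have m3 : val s ≤ val t := Nat.le_of_mul_le_mul_left (Nat.le_of_add_le_add_left m1) (by positivity)
  have m4 : val t ≤ val s := by omega
  have hst : s = t := by
    have := Nat.ofDigits_inj_of_len_eq (b := B + 2) (by omega) (by simpa using hlen) (hB s) (hB t)
      (le_antisymm m3 m4)
    refine List.map_injective_iff.2 (fun a b hab => ?_) this
    exact e.injective (Fin.ext hab)
  subst hst
  refine hne ?_
  rw [← HomogQM.apply_eq_of_isConj hα hu3, ← hs, ← mul_mk,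
    HomogQM.apply_mul_of_commute hα (by rw [Commute, SemiconjBy, mul_mk, mul_mk, hs, ht])]
  have l1 := congrArg List.length hs
  have l2 := List.length_pos_of_ne_nil hs0
  have l3 := List.length_pos_of_ne_nil hv
  rw [List.length_append] at l1
  rw [h0 v (by omega), h0 s (by omega), add_zero]

end FreeGroup

/-! ### Interpolation on finite sets -/

namespace FreeGroup

variable {ι : Type v} [Finite ι]

/-- A homogeneous quasimorphism that vanishes on the words of length at most `l` can be matched on
finitely many words of length `l + 1`, one conjugacy class up to inversion at a time. -/
theorem exists_eq_on_finite {γ : FreeGroup ι → ℝ} (hγ : γ ∈ HomogQM (FreeGroup ι)) {l : ℕ}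
    (hl : 1 ≤ l) (h0 : ∀ L : List (ι × Bool), L.length ≤ l → γ (mk L) = 0)
    {T : Set (List (ι × Bool))} (hT : T.Finite) (hTl : ∀ L ∈ T, L.length ≤ l + 1) :
    ∃ β ∈ Submodule.span ℝ (involutionTranslates (FreeGroup ι)),
      (∀ L : List (ι × Bool), L.length ≤ l → β (mk L) = 0) ∧ ∀ L ∈ T, β (mk L) = γ (mk L) := by
  classical
  induction T, hT using Set.Finite.induction_on with
  | empty => exact ⟨0, Submodule.zero_mem _, by simp, by simp⟩
  | @insert L T _ _ ih =>
    obtain ⟨β, hβ, hβ0, hβT⟩ := ih fun L hL => hTl L (Set.mem_insert_of_mem _ hL)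
    by_cases hL : γ (mk L) - β (mk L) = 0
    · refine ⟨β, hβ, hβ0, ?_⟩
      rintro L' (rfl | hL')
      · linarith
      · exact hβT L' hL'
    have hδ : γ - β ∈ HomogQM (FreeGroup ι) :=
      Submodule.sub_mem _ hγ (span_involutionTranslates_le hβ)
    have hδ0 : ∀ L : List (ι × Bool), L.length ≤ l → (γ - β) (mk L) = 0 := fun L hL => by
      rw [Pi.sub_apply, h0 L hL, hβ0 L hL, sub_zero]
    obtain ⟨w, hw, hwl, hc⟩ := exists_isConj_isCyclicallyReduced L
    have hLl := hTl L (Set.mem_insert _ _)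
    have hne : (γ - β) (mk w) ≠ 0 := by
      rw [HomogQM.apply_eq_of_isConj hδ hc]
      exact hL
    have hwl' : w.length = l + 1 := by
      by_contra h
      exact hne (hδ0 w (by omega))
    obtain ⟨u, hu, hub, hul, hcu⟩ := exists_unbordered hδ hw
      (fun L hL => hδ0 L (by omega)) hne
    obtain ⟨ψ, hψ, hψu, hψw⟩ := exists_detecting hu hub (by omega)
    have hψH := span_involutionTranslates_le hψ
    have hneu : (γ - β) (mk u) ≠ 0 := by
      rwa [HomogQM.apply_eq_of_isConj hδ hcu]
    refine ⟨β + ((γ - β) (mk u) / ψ (mk u)) • ψ, Submodule.add_mem _ hβ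
      (Submodule.smul_mem _ _ hψ), fun L' hL' => ?_, ?_⟩
    · obtain ⟨w', hw', hwl'', hc'⟩ := exists_isConj_isCyclicallyReduced L'
      have : ψ (mk L') = 0 := by
        rw [← HomogQM.apply_eq_of_isConj hψH hc']
        by_contra h
        have := (hψw w' hw' (by omega) h).1
        omega
      simp [hβ0 L' hL', this]
    · rintro L' (rfl | hL')
      · have e1 := HomogQM.apply_eq_of_isConj hψH (hc.trans hcu)
        have e2 := HomogQM.apply_eq_of_isConj hδ (hc.trans hcu)
        rw [Pi.add_apply, Pi.smul_apply, smul_eq_mul, ← e1, div_mul_cancel₀ _ hψu, e2, Pi.sub_apply]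
        ring
      · obtain ⟨w', hw', hwl'', hc'⟩ := exists_isConj_isCyclicallyReduced L'
        have hL'l := hTl L' (Set.mem_insert_of_mem _ hL')
        have : ψ (mk L') = 0 := by
          rw [← HomogQM.apply_eq_of_isConj hψH hc']
          by_contra h
          -- otherwise `L'` is conjugate to `u` or its inverse, where `γ - β` does not vanish
          have hz : (γ - β) (mk w') = 0 := by
            rw [HomogQM.apply_eq_of_isConj hδ hc', Pi.sub_apply, hβT L' hL', sub_self]
          rcases (hψw w' hw' (by omega) h).2 with h1 | h1
          · exact hneu (by rw [HomogQM.apply_eq_of_isConj hδ h1, hz])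
          · exact hneu (by
              rw [HomogQM.apply_eq_of_isConj hδ h1, HomogQM.apply_inv hδ, hz, neg_zero])
        simp [hβT L' hL', this]

/-- Every homogeneous quasimorphism on a free group of finite rank agrees on words of bounded
length with a linear combination of translates of homomorphisms by involutions. -/
theorem exists_eq_on_length_le {α : FreeGroup ι → ℝ} (hα : α ∈ HomogQM (FreeGroup ι)) (l : ℕ) :
    ∃ β ∈ Submodule.span ℝ (involutionTranslates (FreeGroup ι)),
      ∀ L : List (ι × Bool), L.length ≤ l + 1 → β (mk L) = α (mk L) := by
  induction l with
  | zero =>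
    refine ⟨realHom fun i => α (of i), (isAdditive_realHom _).mem_span, fun L hL => ?_⟩
    match L, hL with
    | [], _ =>
      have := hα.2 1 0
      simp only [pow_zero, Nat.cast_zero, zero_mul] at this
      rw [realHom_mk_nil, ← one_eq_mk, this]
    | [(i, b)], _ =>
      rw [realHom_mk_cons, realHom_mk_nil, add_zero]
      cases b
      · have : mk [(i, false)] = (of i)⁻¹ := rfl
        rw [this, HomogQM.apply_inv hα]
        rfl
      · rfl
  | succ l ih =>
    obtain ⟨β, hβ, h⟩ := ih
    obtain ⟨β', hβ', -, h'⟩ := exists_eq_on_finite (γ := α - β) (l := l + 1)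
      (Submodule.sub_mem _ hα (span_involutionTranslates_le hβ)) (by omega)
      (fun L hL => by rw [Pi.sub_apply, h L hL, sub_self])
      (List.finite_length_le (ι × Bool) (l + 1 + 1)) (fun L hL => hL)
    refine ⟨β + β', Submodule.add_mem _ hβ hβ', fun L hL => ?_⟩
    rw [Pi.add_apply, h' L hL, Pi.sub_apply]
    ring

end FreeGroup

/-! ### Density of the translates of homomorphisms -/

theorem RealQM.comp_hom {G : Type u} {H : Type v} [Group G] [Group H] {α : H → ℝ}
    (hα : α ∈ RealQM H) (e : G →* H) : (fun g => α (e g)) ∈ RealQM G := by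
  obtain ⟨D, hD⟩ := hα
  exact ⟨D, fun g h => by simpa using hD (e g) (e h)⟩

theorem HomogQM.comp_hom {G : Type u} {H : Type v} [Group G] [Group H] {α : H → ℝ}
    (hα : α ∈ HomogQM H) (e : G →* H) : (fun g => α (e g)) ∈ HomogQM G :=
  ⟨RealQM.comp_hom hα.1 e, fun g n => by simpa using hα.2 (e g) n⟩

/-- Conjugation by an isomorphism transports involutive quasimorphisms. -/
theorem comp_mem_span_involutionTranslates {G : Type u} {H : Type v} [Group G] [Group H]
    (e : G ≃* H) {β : H → ℝ} (hβ : β ∈ Submodule.span ℝ (involutionTranslates H)) :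
    (fun g => β (e g)) ∈ Submodule.span ℝ (involutionTranslates G) := by
  have h : (Submodule.span ℝ (involutionTranslates H)).map (LinearMap.funLeft ℝ ℝ e) ≤
      Submodule.span ℝ (involutionTranslates G) := by
    rw [Submodule.map_span_le]
    rintro _ ⟨f, hf, hff, χ, hχ, rfl⟩
    refine Submodule.subset_span ⟨fun g => e.symm (f (e g)), fun α hα => ?_, fun g => by simp [hff],
      fun g => χ (e g), fun g h => by simp [hχ _ _], ?_⟩
    · exact RealQM.comp_hom (hf _ (RealQM.comp_hom hα (e.symm : H →* G))) (e : G →* H)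
    · funext g
      simp [LinearMap.funLeft, homogenization]
  exact h ⟨β, hβ, rfl⟩

/-- An involutive quasimorphism represents an element of order at most two of `QOut G`. -/
theorem span_involutionTranslates_le_map {G : Type u} [Group G] :
    Submodule.span ℝ (involutionTranslates G) ≤
      (spanOrbitHom (QOutOrderLE 2 G)).map (HomogQM G).subtype := by
  rw [Submodule.span_le]
  rintro _ ⟨f, hf, hff, χ, hχ, rfl⟩
  have hc : QQ.comp (QQ.mk f hf) (QQ.mk f hf) = QQ.id G := by
    refine Quotient.sound fun α _ => ⟨0, fun g => ?_⟩
    simp [hff]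
  let φ : QOut G := ⟨QQ.mk f hf, QQ.mk f hf, hc, hc⟩
  have hφ : φ ^ 2 = 1 := by
    rw [pow_two]
    exact Iso.ext hc
  refine ⟨QOut.act φ ⟨χ, hχ.mem_homogQM⟩, Submodule.subset_span ⟨φ, Subgroup.subset_closure ⟨?_, ?_⟩,
    _, hχ, rfl⟩, rfl⟩
  · exact isOfFinOrder_iff_pow_eq_one.2 ⟨2, by norm_num, hφ⟩
  · exact Nat.le_of_dvd (by norm_num) (orderOf_dvd_of_pow_eq_one hφ)

open FreeGroup in
theorem closure_spanOrbitHom {G : Type u} {ι : Type v} [Group G] [Finite ι]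
    (e : G ≃* FreeGroup ι) :
    closure (spanOrbitHom (QOutOrderLE 2 G) : Set (HomogQM G)) = Set.univ := by
  classical
  refine Set.eq_univ_of_forall fun α => mem_closure_iff.2 fun o ho hα => ?_
  obtain ⟨o', ho', rfl⟩ := isOpen_induced_iff.1 ho
  obtain ⟨I, t, ht, hI⟩ := isOpen_pi_iff.1 ho' _ hα
  obtain ⟨β, hβ, h⟩ := exists_eq_on_length_le (HomogQM.comp_hom α.2 (e.symm : FreeGroup ι →* G))
    (∑ g ∈ I, norm (e g))
  obtain ⟨b, hb, hb'⟩ := span_involutionTranslates_le_map (comp_mem_span_involutionTranslates e hβ)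
  refine ⟨b, hI fun g hg => ?_, hb⟩
  have hlen : (toWord (e g)).length ≤ ∑ g ∈ I, norm (e g) :=
    Finset.single_le_sum (f := fun g => norm (e g)) (fun _ _ => Nat.zero_le _) hg
  have h1 := h _ (hlen.trans (Nat.le_succ _))
  have h2 := congrFun hb' g
  simp only [mk_toWord, MonoidHom.coe_coe, MulEquiv.symm_apply_apply] at h1
  change b.1 g ∈ t g
  rw [show b.1 g = α.1 g from h2.trans h1]
  exact (ht g hg).2

theorem dRed_eq_zero {G : Type u} {ι : Type v} [Group G] [Finite ι] (e : G ≃* FreeGroup ι) :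
    dRed G = 0 := by
  have h : (spanOrbitHom (⊤ : Subgroup (QOut G))).topologicalClosure = ⊤ := by
    rw [← SetLike.coe_set_eq, Submodule.topologicalClosure_coe, Submodule.top_coe,
      Set.eq_univ_iff_forall]
    intro α
    refine closure_mono ?_ ((closure_spanOrbitHom e).symm ▸ Set.mem_univ α)
    refine Submodule.span_mono ?_
    rintro β ⟨φ, -, χ, hχ, rfl⟩
    exact ⟨φ, Subgroup.mem_top _, χ, hχ, rfl⟩
  rw [dRed, h]
  have : Subsingleton (HomogQM G ⧸ (⊤ : Submodule ℝ (HomogQM G))) :=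
    Submodule.Quotient.subsingleton_iff.2 rfl
  rw [rank_subsingleton']
  simp

/-! ### Infinitely many independent quasimorphisms -/

theorem List.unbordered_replicate_append {A : Type v} {a b : A} (hab : a ≠ b) (k : ℕ) :
    (List.replicate k a ++ [b]).Unbordered := by
  rintro v hv hp ⟨t, ht⟩
  rw [List.prefix_concat_iff] at hp
  rcases hp with hp | hp
  · exact hp
  · exfalso
    have h1 : v.getLast? = some b := by
      have := congrArg List.getLast? ht
      rwa [List.getLast?_append_of_ne_nil _ hv, List.getLast?_concat] at this
    have := hp.subset (List.mem_of_getLast? h1)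
    exact hab (List.eq_of_mem_replicate this).symm

namespace FreeGroup

variable {ι : Type v}

theorem eq_zero_of_isAdditive {χ : FreeGroup ι → ℝ} (h : IsAdditive χ) (h0 : ∀ i, χ (of i) = 0)
    (g : FreeGroup ι) : χ g = 0 := by
  have h1 : χ 1 = 0 := by simpa using h 1 1
  induction g using FreeGroup.induction_on with
  | C1 => exact h1
  | of i => exact h0 i
  | inv_of i hi =>
    have := h (of i)⁻¹ (of i)
    rw [inv_mul_cancel, h1] at this
    have h2 := h0 i
    linarith
  | mul x y hx hy => rw [h, hx, hy, add_zero]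

theorem isCyclicallyReduced_of_positive {L : List (ι × Bool)} (h : ∀ c ∈ L, c.2 = true) :
    IsCyclicallyReduced L := by
  refine ⟨?_, fun a ha b hb _ => ?_⟩
  · rw [IsReduced, List.isChain_iff_getElem]
    intro i hi _
    rw [h _ (List.getElem_mem _), h _ (List.getElem_mem _)]
  · rw [h a (List.mem_of_getLast? ha), h b (List.mem_of_head? hb)]

end FreeGroup

open FreeGroup in
theorem dZero_eq_top {G : Type u} {ι : Type v} [Group G] [Finite ι] (e : G ≃* FreeGroup ι)
    {a b : ι} (hab : a ≠ b) : dZero G = ⊤ := by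
  classical
  set U : ℕ → List (ι × Bool) := fun k => List.replicate (k + 1) (a, true) ++ [(b, true)] with hU
  have hlen : ∀ k, (U k).length = k + 2 := fun k => by simp [hU]
  have hcyc : ∀ k, IsCyclicallyReduced (U k) := fun k => isCyclicallyReduced_of_positive fun c hc => by
    simp [hU] at hc
    rcases hc with rfl | rfl <;> rfl
  choose ψ hψ hψU hψw using fun k => exists_detecting (hcyc k)
    (List.unbordered_replicate_append (a := (a, true)) (b := (b, true)) (by simpa using hab) (k + 1))
    (by rw [hlen]; omega)
  have hzero : ∀ k w, IsCyclicallyReduced w → w.length < k + 2 → ψ k (mk w) = 0 := by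
    intro k w hw hl
    by_contra h
    have := (hψw k w hw (by rw [hlen]; omega) h).1
    rw [hlen] at this
    omega
  set Ψ : ℕ → HomogQM G := fun k => ⟨fun g => ψ k (e g),
    HomogQM.comp_hom (span_involutionTranslates_le (hψ k)) (e : G →* FreeGroup ι)⟩ with hΨ
  have hli : LinearIndependent ℝ fun k => (HomReal G).mkQ (Ψ k) := by
    rw [linearIndependent_iff']
    intro s c hs
    simp only [← map_smul, ← map_sum] at hs
    rw [Submodule.mkQ_apply, Submodule.Quotient.mk_eq_zero] at hs
    have hval : ∀ g, (∑ k ∈ s, c k • Ψ k).1 g = ∑ k ∈ s, c k * ψ k (e g) := by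
      intro g
      simp [hΨ, Finset.sum_apply]
    -- the sum is a homomorphism that vanishes on the generators
    have hz : ∀ x : FreeGroup ι, ∑ k ∈ s, c k * ψ k x = 0 := by
      refine eq_zero_of_isAdditive (fun x y => ?_) fun i => ?_
      · have := hs (e.symm x) (e.symm y)
        rw [hval, hval, hval] at this
        simpa using this
      · refine Finset.sum_eq_zero fun k _ => ?_
        rw [show of i = mk [(i, true)] from rfl, hzero k _ IsCyclicallyReduced.singleton (by simp),
          mul_zero]
    intro k
    induction k using Nat.strong_induction_on with
    | _ k ih =>
      intro hk
      have h1 := hz (mk (U k))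
      rw [Finset.sum_eq_single k ?_ fun h => absurd hk h] at h1
      · exact (mul_eq_zero.1 h1).resolve_right (hψU k)
      · intro j hj hjk
        rcases lt_or_gt_of_ne hjk with h | h
        · rw [ih j h hj, zero_mul]
        · rw [hzero j _ (hcyc k) (by rw [hlen]; omega), mul_zero]
  have := hli.cardinal_lift_le_rank
  rw [dZero, Cardinal.toENat_eq_top]
  simpa using this

/-! ### Finitely generated free groups -/

namespace FreeGroup

theorem finite_of_fg {ι : Type v} [Group.FG (FreeGroup ι)] : Finite ι := by
  classical
  obtain ⟨S, hS⟩ := (Group.fg_def (G := FreeGroup ι)).1 inferInstance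
  set J : Finset ι := S.biUnion fun g => (g.toWord.map Prod.fst).toFinset with hJ
  refine Finite.of_finite_univ (J.finite_toSet.subset fun i _ => ?_)
  by_contra hi
  -- the exponent sum of a generator that does not occur in `S`
  set v : ι → ℝ := fun k => if k = i then 1 else 0 with hv
  have key : ∀ L : List (ι × Bool), (∀ c ∈ L, c.1 ≠ i) → realHom v (mk L) = 0 := by
    intro L hL
    induction L with
    | nil => exact realHom_mk_nil v
    | cons c L ih =>
      rw [realHom_mk_cons, ih fun d hd => hL d (List.mem_cons_of_mem _ hd)]
      have : v c.1 = 0 := by simp [hv, hL c List.mem_cons_self]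
      simp [this]
  have hS' : (⊤ : Subgroup (FreeGroup ι)) ≤
      (lift fun k => Multiplicative.ofAdd (v k)).ker := by
    rw [← hS, Subgroup.closure_le]
    intro g hg
    have := key g.toWord fun c hc e => hi (by
      simp only [hJ, Finset.coe_biUnion, Set.mem_iUnion]
      exact ⟨g, hg, by
        rw [List.coe_toFinset]
        exact List.mem_map.2 ⟨c, hc, e⟩⟩)
    rw [mk_toWord] at this
    exact Multiplicative.toAdd.injective this
  have h1 := hS' (Subgroup.mem_top (of i))
  rw [MonoidHom.mem_ker, lift_apply_of] at h1
  have := congrArg Multiplicative.toAdd h1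
  simp [hv] at this

theorem commute_of_subsingleton {ι : Type v} [Subsingleton ι] (g h : FreeGroup ι) :
    Commute g h := by
  induction g using FreeGroup.induction_on with
  | C1 => exact Commute.one_left h
  | of i =>
    induction h using FreeGroup.induction_on with
    | C1 => exact Commute.one_right _
    | of j => rw [Subsingleton.elim i j]
    | inv_of j hj => exact hj.inv_right
    | mul x y hx hy => exact hx.mul_right hy
  | inv_of i hi => exact hi.inv_left
  | mul x y hx hy => exact hx.mul_left hy

end FreeGroup

end
theorem theorem4 :
    (∀ n : ℕ, 1 ≤ n →
      closure (spanOrbitHom (QOutOrderLE 2 (FreeGroup (Fin n))) : Set (HomogQM (FreeGroup (Fin n))))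
        = Set.univ) ∧
    (∀ (F : Type u) [Group F] [IsFreeGroup F] [Group.FG F],
      (∃ a b : F, a * b ≠ b * a) → dZero F = ⊤ ∧ dRed F = 0) := by
  refine ⟨fun n _ => closure_spanOrbitHom (MulEquiv.refl _), fun F _ _ _ hF => ?_⟩
  let e := IsFreeGroup.toFreeGroup F
  have : Group.FG (FreeGroup (IsFreeGroup.Generators F)) :=
    Group.fg_of_surjective (f := (e : F →* _)) e.surjective
  have : Finite (IsFreeGroup.Generators F) := FreeGroup.finite_of_fg
  refine ⟨?_, dRed_eq_zero e⟩
  obtain ⟨a, b, hab⟩ := hF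
  have : Nontrivial (IsFreeGroup.Generators F) := by
    by_contra h
    rw [not_nontrivial_iff_subsingleton] at h
    refine hab (e.injective ?_)
    rw [map_mul, map_mul]
    exact FreeGroup.commute_of_subsingleton _ _
  obtain ⟨i, j, hij⟩ := exists_pair_ne (IsFreeGroup.Generators F)
  exact dZero_eq_top e hij
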